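/- Let $k$ be a field, $A=k[x_1,\dots,x_n]$ and $\otimes=\otimes_k$. Let $TA=\bigoplus_r A^{\otimes r}$ with the deconcatenation coproduct, and let $W\subset TA$ be the subcoalgebra spanned by the orbit sums $o(v_1,\dots,v_r)=\sum_{\sigma\in S_r}\mathrm{sgn}(\sigma)\,v_{\sigma(1)}\otimes\cdots\otimes v_{\sigma(r)}$ of linear forms $v_1,\dots,v_r$, so that the $o(x_I)=o(x_{i_1},\dots,x_{i_s})$ with $i_1<\dots<i_s$ form a $k$-basis of $W$. Let $K=A\otimes W\otimes A$ be the Koszul bimodule resolution of $A$, with differential $$1\otimes o(x_I)\otimes 1\mapsto\sum_l(-1)^{l+1}\bigl(x_{i_l}\otimes o(x_{I\setminus i_l})\otimes 1-1\otimes o(x_{I\setminus i_l})\otimes x_{i_l}\bigr),$$ let $\Delta_K\colon K\to K\otimes_AK$ be the bimodule map induced by the coproduct of $W$, and put $\Delta_K^{(2)}=(\Delta_K\otimes_A\mathrm{id})\Delta_K$. Identify $K\otimes_AK=A\otimes W\otimes A\otimes W\otimes A$ and let $\phi\colon K\otimes_AK\to K$ be the $A$-bimodule map with $$\phi\bigl(1\otimes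 o(x_I)\otimes x_{j_1}\cdots x_{j_t}\otimes o(x_L)\otimes 1\bigr)=\sum_{\nu:\ \max L<j_\nu<\min I}(-1)^{|I||L|+|L|}\,x_{j_1}\cdots x_{j_{\nu-1}}\otimes o(x_L,x_{j_\nu},x_I)\otimes x_{j_{\nu+1}}\cdots x_{j_t}$$ for $I,L$ increasing and $j_1\le\dots\le j_t$ (a condition involving an empty $I$ or $L$ is void). For homogeneous $f,g\in\mathrm{Hom}_{A^e}(K,A)$ put $$f\circ_\phi g=f\,\phi\,(\mathrm{id}_K\otimes_A g\otimes_A\mathrm{id}_K)\,\Delta_K^{(2)},\qquad [f,g]_\phi=f\circ_\phi g-(-1)^{(|f|-1)(|g|-1)}g\circ_\phi f,$$ where $(\mathrm{id}\otimes g\otimes\mathrm{id})(x\otimes y\otimes z)=(-1)^{|x||g|}x\otimes g(y)\otimes z$. Let $A[\partial_1,\dots,\partial_n]$ be the free graded commutative $A$-algebra on generators $\partial_i$ of degree $1$ (the exterior algebra of $A^n$); map it $A$-linearly to $\mathrm{Hom}_{A^e}(K,A)$ by sending $\partial_I=\partial_{i_1}\cdots\partial_{i_s}$ to the function dual to $(-1)^{1+2+\cdots+(s-1)}o(x_{i_1},\dots,x_{i_s})$.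 (1) This map is an isomorphism $A[\partial_1,\dots,\partial_n]\cong\mathrm{Hom}_{A^e}(K,A)$, and the differential of the complex $\mathrm{Hom}_{A^e}(K,A)$ is zero, so that this complex equals its own cohomology $\mathrm{HH}(A)$. (2) For all $a,b\in A$ and all finite sequences $I=(i_1,\dots,i_{|I|})$, $J=(j_1,\dots,j_{|J|})$ in $\{1,\dots,n\}$ (in particular for ordered subsets), writing $I(r)=(i_1,\dots,i_{r-1})$, $I'(r)=(i_{r+1},\dots,i_{|I|})$ and $\amalg$ for concatenation, $$(a\partial_I)\circ_\phi(b\partial_J)=\sum_{1\le r\le|I|}(-1)^{(|I|-r)(|J|-1)}\,a\,\frac{\partial b}{\partial x_{i_r}}\,\partial_{I(r)\amalg J\amalg I'(r)}.$$ (3) Likewise $$[a\partial_I,b\partial_J]_\phi=\sum_{1\le r\le|I|}(-1)^{(|I|-r)(|J|-1)}a\frac{\partial b}{\partial x_{i_r}}\partial_{I(r)\amalg J\amalg I'(r)}-\sum_{1\le l\le|J|}(-1)^{(l-1)(|I|-1)}b\frac{\partial a}{\partial x_{j_l}}\partial_{J(l)\amalg I\amalg J'(l)}.$$ (4) Under the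 isomorphism of (1), $[\ ,\ ]_\phi$ is the Schouten–Nijenhuis bracket, that is, the unique $k$-bilinear operation on $A[\partial_1,\dots,\partial_n]$ with $[a,b]=0$, $[a\partial_i,b]=a\frac{\partial b}{\partial x_i}$ and $[a\partial_i,b\partial_j]=a\frac{\partial b}{\partial x_i}\partial_j-b\frac{\partial a}{\partial x_j}\partial_i$ for $a,b\in A$, and with $[\omega,\eta]=-(-1)^{(|\omega|-1)(|\eta|-1)}[\eta,\omega]$ and $[\omega,\eta\zeta]=[\omega,\eta]\zeta+(-1)^{(|\omega|-1)|\eta|}\eta[\omega,\zeta]$ for homogeneous $\omega,\eta$ and arbitrary $\zeta$. -/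

import Mathlib

open scoped TensorProduct DirectSum

noncomputable section

namespace KoszulPoly

variable (k : Type*) [Field k] (n : ℕ)

/-- The polynomial ring `A = k[x_1, …, x_n]`. -/
abbrev A : Type _ := MvPolynomial (Fin n) k

/-! ### The tensor coalgebra and the subcoalgebra of orbit sums -/

/-- The tensor coalgebra `TA = ⨁_r A^{⊗ r}`. -/
abbrev TA : Type _ := ⨁ r : ℕ, ⨂[k]^r (A k n)

/-- The component `A^{⊗ r} → A^{⊗ i} ⊗ A^{⊗ j}` (`i + j = r`) of deconcatenation:
`a_1 ⊗ ⋯ ⊗ a_r ↦ (a_1 ⊗ ⋯ ⊗ a_i) ⊗ (a_{i+1} ⊗ ⋯ ⊗ a_r)`. -/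
def splitAt {r i j : ℕ} (h : r = i + j) :
    ⨂[k]^r (A k n) →ₗ[k] (⨂[k]^i (A k n)) ⊗[k] (⨂[k]^j (A k n)) :=
  (TensorPower.mulEquiv (R := k) (M := A k n) (n := i) (m := j)).symm.toLinearMap ∘ₗ
    (TensorPower.cast k (A k n) h).toLinearMap

/-- The deconcatenation coproduct
`Δ(a_1 ⊗ ⋯ ⊗ a_r) = ∑_{i=0}^r (a_1 ⊗ ⋯ ⊗ a_i) ⊗ (a_{i+1} ⊗ ⋯ ⊗ a_r)` of `TA`. -/
def comulTA : TA k n →ₗ[k] TA k n ⊗[k] TA k n :=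
  DirectSum.toModule k ℕ _ fun r => ∑ i : Fin (r + 1),
    TensorProduct.map
        (DirectSum.lof k ℕ (fun r => ⨂[k]^r (A k n)) (i : ℕ))
        (DirectSum.lof k ℕ (fun r => ⨂[k]^r (A k n)) (r - i)) ∘ₗ
      splitAt k n (show r = (i : ℕ) + (r - i) by have := i.2; omega)

/-- The space `V` of linear forms, spanned by `x_1, …, x_n`. -/
def V : Submodule k (A k n) := Submodule.span k (Set.range MvPolynomial.X)

/-- The orbit sum `o(v_1, …, v_r) = ∑_σ sgn(σ) v_{σ(1)} ⊗ ⋯ ⊗ v_{σ(r)}`. -/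
def orbitSum (r : ℕ) : (A k n) [⋀^Fin r]→ₗ[k] ⨂[k]^r (A k n) :=
  MultilinearMap.alternatization (PiTensorProduct.tprod k)

/-- The graded subspace `W ⊆ TA` spanned by the orbit sums of linear forms. -/
def W : Submodule k (TA k n) :=
  Submodule.span k {t | ∃ (r : ℕ) (v : Fin r → A k n), (∀ i, v i ∈ V k n) ∧
    t = DirectSum.lof k ℕ (fun r => ⨂[k]^r (A k n)) r (orbitSum k n r v)}

variable {k n} in
theorem orbitSum_mem_W {r : ℕ} (v : Fin r → A k n) (hv : ∀ i, v i ∈ V k n) :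
    DirectSum.lof k ℕ (fun r => ⨂[k]^r (A k n)) r (orbitSum k n r v) ∈ W k n :=
  Submodule.subset_span ⟨r, v, hv, rfl⟩

variable {n} in
theorem X_mem_V (i : Fin n) : (MvPolynomial.X i : A k n) ∈ V k n :=
  Submodule.subset_span ⟨i, rfl⟩

variable {n} in
/-- `o(x_{i_1}, …, x_{i_r}) ∈ W` for a finite sequence of indices `(i_1, …, i_r)`. -/
def o (l : List (Fin n)) : W k n :=
  ⟨DirectSum.lof k ℕ (fun r => ⨂[k]^r (A k n)) l.length
      (orbitSum k n l.length fun j => MvPolynomial.X (l.get j)),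
    orbitSum_mem_W _ fun _ => X_mem_V k _⟩

/-- The coefficient of `x_{i_1} ⊗ ⋯ ⊗ x_{i_s}`, `I = {i_1 < ⋯ < i_s}`, in an element of `TA`. -/
def coeffTA (I : Finset (Fin n)) : TA k n →ₗ[k] k :=
  DirectSum.toModule k ℕ _ fun r =>
    if h : I.card = r then
      PiTensorProduct.lift ((MultilinearMap.mkPiAlgebra k (Fin r) k).compLinearMap
        fun j => MvPolynomial.lcoeff k (Finsupp.single (I.orderEmbOfFin h j) 1))
    else 0

theorem o_sort_coe (J : Finset (Fin n)) {r : ℕ} (h : J.card = r) :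
    (o k J.sort : TA k n) = DirectSum.lof k ℕ (fun r => ⨂[k]^r (A k n)) r
      (orbitSum k n r fun j => MvPolynomial.X (J.orderEmbOfFin h j)) := by
  obtain rfl : J.sort.length = r := by simp [h]
  rfl

theorem coeffTA_o (I J : Finset (Fin n)) :
    coeffTA k n I (o k J.sort : TA k n) = if I = J then 1 else 0 := by
  rw [o_sort_coe k n J rfl, coeffTA, DirectSum.toModule_lof]
  by_cases h : I.card = J.card
  · rw [dif_pos h]
    simp only [orbitSum, MultilinearMap.alternatization_apply, map_sum,
      MultilinearMap.domDomCongr_apply]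
    by_cases hIJ : I = J
    · subst hIJ
      rw [if_pos rfl, Finset.sum_eq_single 1]
      · simp [PiTensorProduct.lift.tprod, MvPolynomial.coeff_X]
      · intro σ _ hσ
        obtain ⟨j, hj⟩ : ∃ j, σ j ≠ j := by
          by_contra hc
          push Not at hc
          exact hσ (Equiv.ext hc)
        rw [map_zsmul_unit, PiTensorProduct.lift.tprod, MultilinearMap.compLinearMap_apply,
          MultilinearMap.mkPiAlgebra_apply, Finset.prod_eq_zero (Finset.mem_univ j), smul_zero]
        simp [MvPolynomial.lcoeff, MvPolynomial.coeff_X, Finsupp.single_left_inj, hj]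
      · simp
    · rw [if_neg hIJ]
      refine Finset.sum_eq_zero fun σ _ => ?_
      obtain ⟨j, hj⟩ : ∃ j, J.orderEmbOfFin rfl (σ j) ≠ I.orderEmbOfFin h j := by
        by_contra hc
        push Not at hc
        apply hIJ
        have h1 : Set.range (I.orderEmbOfFin h) = Set.range (J.orderEmbOfFin rfl) := by
          rw [← σ.surjective.range_comp (J.orderEmbOfFin rfl)]
          congr 1
          funext j
          exact (hc j).symm
        simpa using h1
      rw [map_zsmul_unit, PiTensorProduct.lift.tprod, MultilinearMap.compLinearMap_apply,
        MultilinearMap.mkPiAlgebra_apply, Finset.prod_eq_zero (Finset.mem_univ j), smul_zero]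
      simp [MvPolynomial.lcoeff, MvPolynomial.coeff_X, Finsupp.single_left_inj, hj]
  · rw [dif_neg h, if_neg (fun e => h (by rw [e])), LinearMap.zero_apply]

theorem linearIndependent_o : LinearIndependent k fun I : Finset (Fin n) => o k I.sort := by
  rw [linearIndependent_iff'ₛ]
  intro s f g hfg I hI
  have h := congrArg (fun w : W k n => coeffTA k n I (w : TA k n)) hfg
  simpa [map_sum, coeffTA_o, hI] using h

theorem W_le_span :
    W k n ≤ Submodule.span k (Set.range fun I : Finset (Fin n) => (o k I.sort : TA k n)) := by
  refine Submodule.span_le.2 ?_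
  rintro _ ⟨r, v, hv, rfl⟩
  let x : Fin n → V k n := fun i => ⟨MvPolynomial.X i, X_mem_V k i⟩
  have hx : Submodule.span k (Set.range x) = ⊤ := by
    apply Submodule.map_injective_of_injective (V k n).injective_subtype
    rw [Submodule.map_span, ← Set.range_comp, Submodule.map_top, Submodule.range_subtype]
    rfl
  let F : ⋀[k]^r (V k n) →ₗ[k] TA k n :=
    DirectSum.lof k ℕ (fun r => ⨂[k]^r (A k n)) r ∘ₗ
      exteriorPower.alternatingMapLinearEquiv
        ((orbitSum k n r).compLinearMap (V k n).subtype)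
  have hF : ∀ u : Fin r → V k n, F (exteriorPower.ιMulti k r u) =
      DirectSum.lof k ℕ (fun r => ⨂[k]^r (A k n)) r (orbitSum k n r fun i => (u i : A k n)) := by
    intro u
    simp only [F, LinearMap.comp_apply, exteriorPower.alternatingMapLinearEquiv_apply_ιMulti,
      AlternatingMap.compLinearMap_apply]
    rfl
  have h1 := hF fun i => ⟨v i, hv i⟩
  simp only at h1
  rw [SetLike.mem_coe, ← h1]
  have h2 : exteriorPower.ιMulti k r (fun i => (⟨v i, hv i⟩ : V k n)) ∈
      Submodule.span k (Set.range (exteriorPower.ιMulti_family k r x)) := by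
    rw [exteriorPower.ιMulti_family_span_of_span k hx]
    trivial
  have h3 := Submodule.mem_map_of_mem (f := F) h2
  rw [Submodule.map_span, ← Set.range_comp] at h3
  refine Submodule.span_mono ?_ h3
  rintro _ ⟨s, rfl⟩
  refine ⟨s.1, ?_⟩
  change (o k s.1.sort : TA k n) = F (exteriorPower.ιMulti k r _)
  rw [hF, o_sort_coe k n s.1 s.2]
  rfl

theorem span_o : ⊤ ≤ Submodule.span k (Set.range fun I : Finset (Fin n) => o k I.sort) := by
  have h : Submodule.map (W k n).subtype ⊤ ≤ Submodule.map (W k n).subtype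
      (Submodule.span k (Set.range fun I : Finset (Fin n) => o k I.sort)) := by
    rw [Submodule.map_top, Submodule.range_subtype, Submodule.map_span, ← Set.range_comp]
    exact W_le_span k n
  exact (Submodule.map_le_map_iff_of_injective (W k n).injective_subtype _ _).1 h

/-- The basis of `W` given by `o(x_{i_1}, …, x_{i_s})`, `i_1 < ⋯ < i_s`. -/
def basisW : Module.Basis (Finset (Fin n)) k (W k n) :=
  Module.Basis.mk (linearIndependent_o k n) (span_o k n)

theorem domCoprod_mem {R M N₁ N₂ ιa ιb : Type*} [CommRing R] [AddCommGroup M] [Module R M]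
    [AddCommGroup N₁] [Module R N₁] [AddCommGroup N₂] [Module R N₂]
    [Fintype ιa] [Fintype ιb] [DecidableEq ιa] [DecidableEq ιb]
    (a : M [⋀^ιa]→ₗ[R] N₁) (b : M [⋀^ιb]→ₗ[R] N₂) (S : Submodule R (N₁ ⊗[R] N₂))
    (v : ιa ⊕ ιb → M)
    (h : ∀ σ : Equiv.Perm (ιa ⊕ ιb),
      (a fun i => v (σ (Sum.inl i))) ⊗ₜ[R] (b fun i => v (σ (Sum.inr i))) ∈ S) :
    a.domCoprod b v ∈ S := by
  rw [AlternatingMap.domCoprod_apply, sum_apply]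
  refine Submodule.sum_mem _ fun σ _ => ?_
  induction σ using Quotient.inductionOn' with
  | h σ =>
    rw [AlternatingMap.domCoprod.summand_mk'', smul_apply]
    exact Submodule.smul_of_tower_mem _ _ (h σ)

theorem splitAt_orbitSum_mem {r i j : ℕ} (h : r = i + j) (v : Fin r → A k n)
    (hv : ∀ l, v l ∈ V k n) :
    TensorProduct.map
        (DirectSum.lof k ℕ (fun r => ⨂[k]^r (A k n)) i)
        (DirectSum.lof k ℕ (fun r => ⨂[k]^r (A k n)) j)
      (splitAt k n h (orbitSum k n r v)) ∈
    LinearMap.range (TensorProduct.map (W k n).subtype (W k n).subtype) := by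
  subst h
  have key : splitAt k n rfl (orbitSum k n (i + j) v) =
      ((orbitSum k n i).domCoprod (orbitSum k n j)) (fun s => v (finSumFinEquiv s)) := by
    rw [orbitSum, orbitSum, orbitSum, ← MultilinearMap.domCoprod_alternization,
      MultilinearMap.alternatization_apply, MultilinearMap.alternatization_apply, map_sum]
    refine Fintype.sum_equiv finSumFinEquiv.symm.permCongr _ _ fun σ => ?_
    rw [map_zsmul_unit, Equiv.Perm.sign_permCongr]
    congr 1
    simp only [MultilinearMap.domDomCongr_apply, MultilinearMap.domCoprod_apply]
    rw [splitAt, TensorPower.cast_refl]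
    simp only [LinearMap.comp_apply, LinearEquiv.coe_coe, LinearEquiv.refl_apply]
    rw [LinearEquiv.symm_apply_eq, ← TensorPower.gMul_def, TensorPower.tprod_mul_tprod]
    congr 1
    funext l
    refine Fin.addCases (fun l => ?_) (fun l => ?_) l <;> simp
  rw [key, ← Submodule.mem_comap]
  refine domCoprod_mem _ _ _ _ fun σ => ?_
  exact ⟨⟨_, orbitSum_mem_W _ fun _ => hv _⟩ ⊗ₜ ⟨_, orbitSum_mem_W _ fun _ => hv _⟩, rfl⟩

theorem comulTA_mem (w : W k n) : comulTA k n w ∈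
    LinearMap.range (TensorProduct.map (W k n).subtype (W k n).subtype) := by
  suffices h : W k n ≤ (LinearMap.range
      (TensorProduct.map (W k n).subtype (W k n).subtype)).comap (comulTA k n) from h w.2
  refine Submodule.span_le.2 ?_
  rintro _ ⟨r, v, hv, rfl⟩
  rw [SetLike.mem_coe, Submodule.mem_comap, comulTA, DirectSum.toModule_lof, LinearMap.sum_apply]
  exact Submodule.sum_mem _ fun i _ => splitAt_orbitSum_mem k n _ v hv

theorem map_subtype_injective :
    Function.Injective (TensorProduct.map (W k n).subtype (W k n).subtype) :=
  have : Module.Free k (W k n) := Module.Free.of_basis (basisW k n)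
  TensorProduct.map_injective_of_flat_flat _ _ (W k n).injective_subtype
    (W k n).injective_subtype

/-- The coproduct of the subcoalgebra `W ⊆ TA`: the restriction of deconcatenation. -/
def comulW : W k n →ₗ[k] W k n ⊗[k] W k n :=
  (LinearEquiv.ofInjective _ (map_subtype_injective k n)).symm.toLinearMap ∘ₗ
    (comulTA k n ∘ₗ (W k n).subtype).codRestrict _ (comulTA_mem k n)

/-! ### The Koszul resolution -/

/-- The bimodule tensor product `K ⊗_A X`, where `K = A ⊗ W ⊗ A`, in the form `A ⊗ W ⊗ X`:
the element `(a ⊗ w ⊗ a') ⊗_A x` is `a ⊗ w ⊗ a' x`. All unadorned tensor products are over `k`. -/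
abbrev KTensor (X : Type*) [AddCommMonoid X] [Module k X] : Type _ :=
  A k n ⊗[k] (W k n ⊗[k] X)

/-- `K = A ⊗ W ⊗ A`. -/
abbrev K : Type _ := KTensor k n (A k n)

/-- `K ⊗_A K = A ⊗ W ⊗ A ⊗ W ⊗ A`. -/
abbrev KK : Type _ := KTensor k n (K k n)

/-- `K ⊗_A K ⊗_A K = A ⊗ W ⊗ A ⊗ W ⊗ A ⊗ W ⊗ A`. -/
abbrev KKK : Type _ := KTensor k n (KK k n)

/-- The left action of `A` on `K`: `b · (a ⊗ w ⊗ a') = b a ⊗ w ⊗ a'`. -/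
def lact : A k n →ₗ[k] K k n →ₗ[k] K k n :=
  LinearMap.rTensorHom (W k n ⊗[k] A k n) ∘ₗ LinearMap.mul k (A k n)

/-- The right action of `A` on `K`: `(a ⊗ w ⊗ a') · b = a ⊗ w ⊗ a' b`. -/
def ract : A k n →ₗ[k] K k n →ₗ[k] K k n :=
  LinearMap.lTensorHom (A k n) ∘ₗ LinearMap.lTensorHom (W k n) ∘ₗ (LinearMap.mul k (A k n)).flip

/-- The map `A ⊗ K ⊗ A → K`, `a ⊗ z ⊗ a' ↦ a · z · a'`. -/
def biact : A k n ⊗[k] (K k n ⊗[k] A k n) →ₗ[k] K k n :=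
  TensorProduct.lift (lact k n) ∘ₗ LinearMap.lTensor (A k n) (TensorProduct.lift (ract k n).flip)

/-- The differential of `K`: the bimodule map with
`1 ⊗ o(x_{i_1}, …, x_{i_s}) ⊗ 1 ↦ ∑_l (-1)^{l+1} (x_{i_l} ⊗ o(…, x̂_{i_l}, …) ⊗ 1
  - 1 ⊗ o(…, x̂_{i_l}, …) ⊗ x_{i_l})`; below, `l` is counted from `0`. -/
def koszulD : K k n →ₗ[k] K k n :=
  biact k n ∘ₗ LinearMap.lTensor (A k n) (LinearMap.rTensor (A k n)
    ((basisW k n).constr k fun I => ∑ l : Fin I.sort.length, (-1 : k) ^ (l : ℕ) •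
      ((MvPolynomial.X I.sort[l] : A k n) ⊗ₜ[k] (o k (I.sort.eraseIdx l) ⊗ₜ[k] (1 : A k n)) -
        (1 : A k n) ⊗ₜ[k] (o k (I.sort.eraseIdx l) ⊗ₜ[k] (MvPolynomial.X I.sort[l] : A k n)))))

/-- The map `Δ_K ⊗_A id_X : K ⊗_A X → K ⊗_A K ⊗_A X`,
`a ⊗ w ⊗ x ↦ ∑ a ⊗ w_1 ⊗ 1 ⊗ w_2 ⊗ x`. -/
def comulTensor (X : Type*) [AddCommMonoid X] [Module k X] :
    KTensor k n X →ₗ[k] KTensor k n (KTensor k n X) :=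
  LinearMap.lTensor (A k n)
    (LinearMap.lTensor (W k n) (TensorProduct.mk k (A k n) (W k n ⊗[k] X) 1) ∘ₗ
      (TensorProduct.assoc k (W k n) (W k n) X).toLinearMap ∘ₗ
        LinearMap.rTensor X (comulW k n))

/-- The diagonal `Δ_K : K → K ⊗_A K`, `a ⊗ w ⊗ a' ↦ ∑ (a ⊗ w_1 ⊗ 1) ⊗_A (1 ⊗ w_2 ⊗ a')`. -/
def comulK : K k n →ₗ[k] KK k n := comulTensor k n (A k n)

/-- `Δ_K^{(2)} = (Δ_K ⊗_A id_K) Δ_K : K → K ⊗_A K ⊗_A K`. -/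
def comulK₂ : K k n →ₗ[k] KKK k n := comulTensor k n (K k n) ∘ₗ comulK k n

variable {n} in
/-- The value of `φ` on the ordered monomial `1 ⊗ o(x_I) ⊗ x^m ⊗ o(x_L) ⊗ 1`, where
`x^m = x_{j_1} ⋯ x_{j_t}` with `j_1 ≤ ⋯ ≤ j_t`:
`∑_{max L < j_ν < min I} (-1)^{|I||L|+|L|} x_{j_1} ⋯ x_{j_{ν-1}} ⊗ o(x_L, x_{j_ν}, x_I) ⊗
x_{j_{ν+1}} ⋯ x_{j_t}`. A condition on an empty `I` or `L` is void. -/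
def phiMonomial (I : Finset (Fin n)) (m : Fin n →₀ ℕ) (L : Finset (Fin n)) : K k n :=
  let j : List (Fin n) := (Finsupp.toMultiset m).sort
  ∑ ν : Fin j.length, if (∀ l ∈ L, l < j[ν]) ∧ (∀ i ∈ I, j[ν] < i) then
    (-1 : k) ^ (I.card * L.card + L.card) •
      (((j.take ν).map MvPolynomial.X).prod ⊗ₜ[k]
        (o k (L.sort ++ j[ν] :: I.sort) ⊗ₜ[k] ((j.drop (ν + 1)).map MvPolynomial.X).prod))
  else 0

/-- `φ` on the generating subspace `k ⊗ W ⊗ A ⊗ W ⊗ k` of `K ⊗_A K`. -/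
def phiGen : W k n →ₗ[k] A k n →ₗ[k] W k n →ₗ[k] K k n :=
  (basisW k n).constr k fun I => (MvPolynomial.basisMonomials (Fin n) k).constr k fun m =>
    (basisW k n).constr k fun L => phiMonomial k I m L

/-- The bimodule map `φ : K ⊗_A K → K`,
`a ⊗ w ⊗ c ⊗ w' ⊗ a' ↦ a · φ(1 ⊗ w ⊗ c ⊗ w' ⊗ 1) · a'`. -/
def phi : KK k n →ₗ[k] K k n :=
  biact k n ∘ₗ LinearMap.lTensor (A k n)
    (TensorProduct.lift
      (TensorProduct.uncurry (RingHom.id k) (A k n) (W k n ⊗[k] A k n) (K k n ⊗[k] A k n) ∘ₗ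
        (phiGen k n).compr₂ (LinearMap.rTensorHom (A k n))))

/-! ### Cochains, the circle product and the bracket -/

/-- `Hom_{A^e}(K, A)`, as a subspace of `Hom_k(K, A)`. -/
def cochains : Submodule k (K k n →ₗ[k] A k n) where
  carrier := {f | (∀ a z, f (lact k n a z) = a * f z) ∧ ∀ a z, f (ract k n a z) = f z * a}
  add_mem' := fun hf hg => ⟨fun a z => by simp [hf.1, hg.1, mul_add],
    fun a z => by simp [hf.2, hg.2, add_mul]⟩
  zero_mem' := by simp
  smul_mem' := fun c f hf => ⟨fun a z => by simp [hf.1], fun a z => by simp [hf.2]⟩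

/-- The operator `w ↦ (-1)^{|w| q} w` on `W`. -/
def signW (q : ℕ) : W k n →ₗ[k] W k n :=
  (basisW k n).constr k fun I => (-1 : k) ^ (I.card * q) • o k I.sort

variable {k n}

/-- `g ⊗_A id_K : K ⊗_A K → A ⊗_A K = K`. -/
def tensorId (g : K k n →ₗ[k] A k n) : KK k n →ₗ[k] K k n :=
  TensorProduct.lift (lact k n) ∘ₗ
    LinearMap.rTensor (K k n)
      (g ∘ₗ LinearMap.lTensor (A k n) ((TensorProduct.mk k (W k n) (A k n)).flip 1)) ∘ₗ
    (TensorProduct.assoc k (A k n) (W k n) (K k n)).symm.toLinearMap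

/-- `id_K ⊗_A g ⊗_A id_K : K ⊗_A K ⊗_A K → K ⊗_A K` for `g` of degree `q`, with the Koszul sign:
`x ⊗ y ⊗ z ↦ (-1)^{|x| q} x ⊗ g(y) ⊗ z`. -/
def idTensorId (q : ℕ) (g : K k n →ₗ[k] A k n) : KKK k n →ₗ[k] KK k n :=
  LinearMap.lTensor (A k n) (TensorProduct.map (signW k n q) (tensorId g))

/-- The `φ`-circle product `f ∘_φ g = f φ (id_K ⊗_A g ⊗_A id_K) Δ_K^{(2)}`, `|g| = q`. -/
def circ (q : ℕ) (f g : K k n →ₗ[k] A k n) : K k n →ₗ[k] A k n :=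
  f ∘ₗ phi k n ∘ₗ idTensorId q g ∘ₗ comulK₂ k n

/-- The `φ`-bracket `[f, g]_φ = f ∘_φ g - (-1)^{(|f|-1)(|g|-1)} g ∘_φ f`, `|f| = p`, `|g| = q`. -/
def bracket (p q : ℕ) (f g : K k n →ₗ[k] A k n) : K k n →ₗ[k] A k n :=
  circ q f g - (Int.negOnePow (((p : ℤ) - 1) * ((q : ℤ) - 1)) : ℤ) • circ p g f

/-! ### Polyvector fields -/

variable (k n)

/-- `A[∂_1, …, ∂_n]`, the free graded commutative `A`-algebra on generators of degree `1`,
i.e. the exterior algebra of the free module `A^n`. -/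
abbrev Polyvector : Type _ := ExteriorAlgebra (A k n) (Fin n → A k n)

variable {n} in
/-- The generator `∂_i`. -/
def del (i : Fin n) : Polyvector k n := ExteriorAlgebra.ι (A k n) (Pi.single i 1)

variable {n} in
/-- `∂_I = ∂_{i_1} ⋯ ∂_{i_s}` for a finite sequence `I = (i_1, …, i_s)`. -/
def delList (I : List (Fin n)) : Polyvector k n := (I.map (del k)).prod

variable {n} in
/-- For `I = {i_1 < ⋯ < i_s}`, the `A`-linear form on polyvector fields with
`m_1 ⋯ m_s ↦ (-1)^{1+⋯+(s-1)} det((m_a)_{i_b})` for `m_1, …, m_s ∈ A^n`, zero outside degree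
`s`. -/
def polyvectorCoeff (I : Finset (Fin n)) : Polyvector k n →ₗ[A k n] A k n :=
  ExteriorAlgebra.liftAlternating fun s =>
    if h : I.card = s then
      (-1 : A k n) ^ (s * (s - 1) / 2) •
        (Matrix.detRowAlternating (n := Fin s) (R := A k n)).compLinearMap
          (LinearMap.funLeft (A k n) (A k n) (I.orderEmbOfFin h))
    else 0

/-- `Hom_k(W, A) → Hom_{A^e}(K, A)`, `h ↦ (a ⊗ w ⊗ a' ↦ a h(w) a')`. -/
def extendW : (W k n →ₗ[k] A k n) →ₗ[A k n] (K k n →ₗ[k] A k n) where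
  toFun h := LinearMap.mul' k (A k n) ∘ₗ LinearMap.lTensor (A k n)
    (LinearMap.mul' k (A k n) ∘ₗ LinearMap.rTensor (A k n) h)
  map_add' h₁ h₂ := by
    ext1
    refine LinearMap.ext fun a => TensorProduct.ext' fun w a' => ?_
    simp [mul_add]
  map_smul' c h := by
    refine TensorProduct.ext' fun a z => ?_
    induction z with
    | zero => simp
    | add x y hx hy => simp only [TensorProduct.tmul_add, map_add, hx, hy]
    | tmul w a' => simp [mul_assoc, mul_left_comm]

/-- The standard isomorphism `A[∂_1, …, ∂_n] → Hom_{A^e}(K, A)`: it sends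
`∂_I = ∂_{i_1} ⋯ ∂_{i_s}` to the function dual to `(-1)^{1+⋯+(s-1)} o(x_{i_1}, …, x_{i_s})`. -/
def toCochain : Polyvector k n →ₗ[A k n] (K k n →ₗ[k] A k n) :=
  extendW k n ∘ₗ ((basisW k n).constr (A k n)).toLinearMap ∘ₗ
    LinearMap.pi fun I => polyvectorCoeff k I

variable {k n}

/-- `β` is a Schouten–Nijenhuis bracket on `A[∂_1, …, ∂_n]`: the `k`-bilinear operation given by
the usual formulas on functions and vector fields and extended to all polyvector fields as a
graded antisymmetric graded biderivation (for the degree shifted by one). -/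
structure IsSchoutenNijenhuis
    (β : Polyvector k n →ₗ[k] Polyvector k n →ₗ[k] Polyvector k n) : Prop where
  fun_fun (a b : A k n) : β (algebraMap _ _ a) (algebraMap _ _ b) = 0
  vector_fun (a b : A k n) (i : Fin n) :
    β (a • del k i) (algebraMap _ _ b) = algebraMap _ _ (a * MvPolynomial.pderiv i b)
  vector_vector (a b : A k n) (i j : Fin n) :
    β (a • del k i) (b • del k j) =
      (a * MvPolynomial.pderiv i b) • del k j - (b * MvPolynomial.pderiv j a) • del k i
  antisymm (p q : ℕ) (ω η : Polyvector k n) (hω : ω ∈ ⋀[A k n]^p (Fin n → A k n))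
    (hη : η ∈ ⋀[A k n]^q (Fin n → A k n)) :
    β ω η = -((Int.negOnePow (((p : ℤ) - 1) * ((q : ℤ) - 1)) : ℤ) • β η ω)
  leibniz (p q : ℕ) (ω η ζ : Polyvector k n) (hω : ω ∈ ⋀[A k n]^p (Fin n → A k n))
    (hη : η ∈ ⋀[A k n]^q (Fin n → A k n)) :
    β ω (η * ζ) = β ω η * ζ + (Int.negOnePow (((p : ℤ) - 1) * (q : ℤ)) : ℤ) • (η * β ω ζ)

end KoszulPoly

end

/-!
Pairing the coproduct of `W` with words concatenates the words, so `∘_φ` is governed by how the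
function dual to `o(x_I)`, `I` increasing, acts on `φ`. It sends `φ(1 ⊗ w ⊗ c ⊗ w' ⊗ 1)` to
`∑_r ± ⟨I'(r), w⟩ ⟨I(r), w'⟩ ∂c/∂x_{i_r}`: on an ordered monomial `c`, the summands of `φ` that
extract the letter `x_{i_r}` are those of the Leibniz rule for `∂c/∂x_{i_r}`.

On polyvector fields this turns `∘_φ` into `∑_i (ω ⌊ dx_i) · ∂η/∂x_i`, and its graded commutator
into `∑_i ((ω ⌊ dx_i) · ∂η/∂x_i - ∂ω/∂x_i · (dx_i ⌋ η))`. Contraction is an antiderivation and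
`∂/∂x_i` a derivation, whence the Leibniz rule of the Schouten–Nijenhuis bracket.
-/

namespace KoszulPoly

/-! ### Words as functionals on `W` -/

section

variable (k : Type*) [Field k] {n : ℕ}

theorem splitAt_tprod_append {i j : ℕ} (v : Fin i → A k n) (w : Fin j → A k n) :
    splitAt k n rfl (PiTensorProduct.tprod k (Fin.append v w)) =
      PiTensorProduct.tprod k v ⊗ₜ[k] PiTensorProduct.tprod k w := by
  rw [splitAt, TensorPower.cast_refl]
  simp only [LinearMap.comp_apply, LinearEquiv.coe_coe, LinearEquiv.refl_apply]
  rw [LinearEquiv.symm_apply_eq, ← TensorPower.gMul_def, TensorPower.tprod_mul_tprod]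

/-- The coefficient of the word `x_{l_1} ⊗ ⋯ ⊗ x_{l_s}` in an element of `TA`. Unlike `coeffTA`,
it is defined for words that need not be increasing. -/
noncomputable def coeffList (l : List (Fin n)) : TA k n →ₗ[k] k :=
  PiTensorProduct.lift ((MultilinearMap.mkPiAlgebra k (Fin l.length) k).compLinearMap
      fun j => MvPolynomial.lcoeff k (Finsupp.single (l[j]'j.2) 1)) ∘ₗ
    DirectSum.component k ℕ (fun r => ⨂[k]^r (A k n)) l.length

theorem coeffList_lof_of_ne {l : List (Fin n)} {r : ℕ} (h : l.length ≠ r) (t : ⨂[k]^r (A k n)) :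
    coeffList k l (DirectSum.lof k ℕ (fun r => ⨂[k]^r (A k n)) r t) = 0 := by
  rw [coeffList, LinearMap.comp_apply, DirectSum.component.of, dif_neg h.symm, map_zero]

theorem coeffList_lof_tprod (l : List (Fin n)) (v : Fin l.length → A k n) :
    coeffList k l (DirectSum.lof k ℕ (fun r => ⨂[k]^r (A k n)) l.length
      (PiTensorProduct.tprod k v)) =
        ∏ j, MvPolynomial.coeff (Finsupp.single (l[j]'j.2) 1) (v j) := by
  rw [coeffList, LinearMap.comp_apply, DirectSum.component.lof_self, PiTensorProduct.lift.tprod]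
  rfl

theorem coeffList_sort (I : Finset (Fin n)) : coeffList k I.sort = coeffTA k n I := by
  refine DirectSum.linearMap_ext k fun r => PiTensorProduct.ext (MultilinearMap.ext fun v => ?_)
  simp only [LinearMap.compMultilinearMap_apply, LinearMap.comp_apply]
  rw [coeffTA, DirectSum.toModule_lof]
  by_cases h : I.card = r
  · obtain rfl : I.sort.length = r := by rw [Finset.length_sort, h]
    rw [dif_pos h, coeffList_lof_tprod, PiTensorProduct.lift.tprod]
    rfl
  · rw [dif_neg h, coeffList_lof_of_ne k (by rwa [Finset.length_sort]), LinearMap.zero_apply]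

theorem dualDistrib_map {R M N M' N' : Type*} [CommSemiring R] [AddCommMonoid M] [Module R M]
    [AddCommMonoid N] [Module R N] [AddCommMonoid M'] [Module R M'] [AddCommMonoid N']
    [Module R N'] (f : Module.Dual R M') (g : Module.Dual R N') (φ : M →ₗ[R] M') (ψ : N →ₗ[R] N')
    (z : M ⊗[R] N) :
    TensorProduct.dualDistrib R M' N' (f ⊗ₜ g) (TensorProduct.map φ ψ z) =
      TensorProduct.dualDistrib R M N ((f ∘ₗ φ) ⊗ₜ (g ∘ₗ ψ)) z := by
  induction z with
  | zero => simp only [map_zero]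
  | add x y hx hy => simp only [map_add, hx, hy]
  | tmul x y => rfl

theorem dualDistrib_coeffList_splitAt (l l' : List (Fin n))
    (t : ⨂[k]^(l.length + l'.length) (A k n)) :
    TensorProduct.dualDistrib k _ _ (coeffList k l ⊗ₜ coeffList k l')
      (TensorProduct.map (DirectSum.lof k ℕ (fun r => ⨂[k]^r (A k n)) l.length)
        (DirectSum.lof k ℕ (fun r => ⨂[k]^r (A k n)) l'.length) (splitAt k n rfl t)) =
      coeffList k (l ++ l')
        (DirectSum.lof k ℕ (fun r => ⨂[k]^r (A k n)) (l.length + l'.length) t) := by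
  induction t using PiTensorProduct.induction_on with
  | add x y hx hy => simp only [map_add, hx, hy]
  | smul_tprod c v =>
    obtain ⟨v, w, rfl⟩ : ∃ v' w', v = Fin.append v' w' :=
      ⟨_, _, (Fin.append_castAdd_natAdd (f := v)).symm⟩
    have key (r : ℕ) (h : (l ++ l').length = r) (u : Fin r → A k n) :
        coeffList k (l ++ l') (DirectSum.lof k ℕ (fun r => ⨂[k]^r (A k n)) r
          (PiTensorProduct.tprod k u)) =
          ∏ j : Fin r, MvPolynomial.coeff (Finsupp.single ((l ++ l')[j]) 1) (u j) := by
      subst h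
      exact coeffList_lof_tprod k _ _
    rw [map_smul, map_smul, map_smul, map_smul, map_smul, splitAt_tprod_append,
      TensorProduct.map_tmul, TensorProduct.dualDistrib_apply, coeffList_lof_tprod,
      coeffList_lof_tprod, key _ List.length_append, Fin.prod_univ_add]
    simp

theorem dualDistrib_coeffList_splitAt_eq_ite (l l' : List (Fin n)) {r i j : ℕ} (h : r = i + j)
    (t : ⨂[k]^r (A k n)) :
    TensorProduct.dualDistrib k _ _ (coeffList k l ⊗ₜ coeffList k l')
      (TensorProduct.map (DirectSum.lof k ℕ (fun r => ⨂[k]^r (A k n)) i)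
        (DirectSum.lof k ℕ (fun r => ⨂[k]^r (A k n)) j) (splitAt k n h t)) =
      if l.length = i then
        coeffList k (l ++ l') (DirectSum.lof k ℕ (fun r => ⨂[k]^r (A k n)) r t)
      else 0 := by
  have comp_lof {l : List (Fin n)} {r : ℕ} (hr : l.length ≠ r) :
      coeffList k l ∘ₗ DirectSum.lof k ℕ (fun r => ⨂[k]^r (A k n)) r = 0 :=
    LinearMap.ext (coeffList_lof_of_ne k hr)
  subst h
  by_cases hi : l.length = i
  · by_cases hj : l'.length = j
    · subst hi hj
      rw [if_pos rfl, dualDistrib_coeffList_splitAt]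
    · rw [if_pos hi, dualDistrib_map, comp_lof hj, TensorProduct.tmul_zero, map_zero,
        LinearMap.zero_apply, coeffList_lof_of_ne k (by rw [List.length_append]; omega)]
  · rw [if_neg hi, dualDistrib_map, comp_lof hi, TensorProduct.zero_tmul, map_zero,
      LinearMap.zero_apply]

theorem dualDistrib_coeffList_comulTA (l l' : List (Fin n)) (t : TA k n) :
    TensorProduct.dualDistrib k _ _ (coeffList k l ⊗ₜ coeffList k l') (comulTA k n t) =
      coeffList k (l ++ l') t := by
  suffices h : TensorProduct.dualDistrib k _ _ (coeffList k l ⊗ₜ coeffList k l') ∘ₗ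
      comulTA k n = coeffList k (l ++ l') from LinearMap.congr_fun h t
  refine DirectSum.linearMap_ext k fun r => LinearMap.ext fun t => ?_
  set c := coeffList k (l ++ l') (DirectSum.lof k ℕ (fun r => ⨂[k]^r (A k n)) r t) with hc
  calc _ = ∑ i : Fin (r + 1), if l.length = i then c else 0 := by
        simp only [LinearMap.comp_apply, comulTA, DirectSum.toModule_lof, LinearMap.sum_apply,
          map_sum, dualDistrib_coeffList_splitAt_eq_ite, hc]
    _ = if l.length ∈ Finset.range (r + 1) then c else 0 := by
        rw [Fin.sum_univ_eq_sum_range fun i => if l.length = i then c else 0, Finset.sum_ite_eq]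
    _ = c := ite_eq_left_iff.2 fun hl => by
        rw [hc, coeffList_lof_of_ne]
        rw [List.length_append]
        rw [Finset.mem_range] at hl
        omega

/-- The restriction of `coeffList` to `W`. -/
noncomputable def coeffW (l : List (Fin n)) : W k n →ₗ[k] k := coeffList k l ∘ₗ (W k n).subtype

theorem map_subtype_comulW (w : W k n) :
    TensorProduct.map (W k n).subtype (W k n).subtype (comulW k n w) = comulTA k n w :=
  congrArg Subtype.val (LinearEquiv.apply_symm_apply
    (LinearEquiv.ofInjective _ (map_subtype_injective k n))
    ((comulTA k n ∘ₗ (W k n).subtype).codRestrict _ (comulTA_mem k n) w))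

theorem dualDistrib_coeffW_comulW (l l' : List (Fin n)) (w : W k n) :
    TensorProduct.dualDistrib k _ _ (coeffW k l ⊗ₜ coeffW k l') (comulW k n w) =
      coeffW k (l ++ l') w := by
  rw [coeffW, coeffW, ← dualDistrib_map, map_subtype_comulW, dualDistrib_coeffList_comulTA]
  rfl

theorem basisW_apply (I : Finset (Fin n)) : basisW k n I = o k I.sort :=
  Module.Basis.mk_apply _ _ _

theorem coeffW_sort_o_sort (I J : Finset (Fin n)) :
    coeffW k I.sort (o k J.sort) = if I = J then 1 else 0 := by
  rw [coeffW, LinearMap.comp_apply, coeffList_sort, Submodule.subtype_apply, coeffTA_o]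

theorem sort_toFinset_of_sortedLT {α : Type*} [LinearOrder α] {l : List α} (h : l.SortedLT) :
    l.toFinset.sort = l :=
  (List.toFinset_sort (· ≤ ·) h.nodup).2 h.sortedLE.pairwise

theorem coeffW_o_of_sortedLT {l l' : List (Fin n)} (h : l.SortedLT) (h' : l'.SortedLT) :
    coeffW k l (o k l') = if l = l' then 1 else 0 := by
  rw [← sort_toFinset_of_sortedLT h, ← sort_toFinset_of_sortedLT h', coeffW_sort_o_sort]
  have sort_injective : Function.Injective fun I : Finset (Fin n) => I.sort :=
    Function.LeftInverse.injective (g := List.toFinset) fun I => I.sort_toFinset (· ≤ ·)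
  exact if_congr sort_injective.eq_iff.symm rfl rfl

theorem coeffW_o_of_length_ne {l l' : List (Fin n)} (h : l.length ≠ l'.length) :
    coeffW k l (o k l') = 0 :=
  coeffList_lof_of_ne k h _

theorem coeffW_signW (q : ℕ) (l : List (Fin n)) (w : W k n) :
    coeffW k l (signW k n q w) = (-1) ^ (l.length * q) * coeffW k l w := by
  suffices h : coeffW k l ∘ₗ signW k n q = (-1 : k) ^ (l.length * q) • coeffW k l from
    LinearMap.congr_fun h w
  refine (basisW k n).ext fun I => ?_
  rw [LinearMap.comp_apply, signW, Module.Basis.constr_basis, LinearMap.smul_apply,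
    basisW_apply, map_smul]
  by_cases h : l.length = I.card
  · rw [h]
  · rw [coeffW_o_of_length_ne k (by rwa [Finset.length_sort]), smul_zero, smul_zero]

end

/-! ### Cochains -/

section

variable {k : Type*} [Field k] {n : ℕ}

theorem lact_tmul (b a : A k n) (y : W k n ⊗[k] A k n) :
    lact k n b (a ⊗ₜ y) = (b * a) ⊗ₜ y := rfl

theorem ract_tmul (b a a' : A k n) (w : W k n) :
    ract k n b (a ⊗ₜ (w ⊗ₜ a')) = a ⊗ₜ (w ⊗ₜ (a' * b)) := rfl

theorem biact_tmul (a a' : A k n) (z : K k n) :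
    biact k n (a ⊗ₜ (z ⊗ₜ a')) = lact k n a (ract k n a' z) := rfl

theorem extendW_tmul (h : W k n →ₗ[k] A k n) (a a' : A k n) (w : W k n) :
    extendW k n h (a ⊗ₜ (w ⊗ₜ a')) = a * (h w * a') := rfl

theorem K_hom_ext {N : Type*} [AddCommMonoid N] [Module k N] {f g : K k n →ₗ[k] N}
    (h : ∀ a w a', f (a ⊗ₜ (w ⊗ₜ a')) = g (a ⊗ₜ (w ⊗ₜ a'))) : f = g :=
  TensorProduct.ext (LinearMap.ext fun a => TensorProduct.ext' fun w a' => h a w a')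

theorem extendW_mem_cochains (h : W k n →ₗ[k] A k n) : extendW k n h ∈ cochains k n := by
  refine ⟨fun a z => ?_, fun a z => ?_⟩
  · suffices e : extendW k n h ∘ₗ lact k n a = LinearMap.mulLeft k a ∘ₗ extendW k n h from
      LinearMap.congr_fun e z
    refine K_hom_ext fun b w b' => ?_
    simp only [LinearMap.comp_apply, lact_tmul, extendW_tmul, LinearMap.mulLeft_apply, mul_assoc]
  · suffices e : extendW k n h ∘ₗ ract k n a = LinearMap.mulRight k a ∘ₗ extendW k n h from
      LinearMap.congr_fun e z
    refine K_hom_ext fun b w b' => ?_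
    simp only [LinearMap.comp_apply, ract_tmul, extendW_tmul, LinearMap.mulRight_apply, mul_assoc]

theorem cochains_apply_tmul {f : K k n →ₗ[k] A k n} (hf : f ∈ cochains k n) (a a' : A k n)
    (w : W k n) : f (a ⊗ₜ (w ⊗ₜ a')) = a * (f (1 ⊗ₜ (w ⊗ₜ 1)) * a') := by
  rw [← hf.2, ← hf.1, ract_tmul, lact_tmul, mul_one, one_mul]

theorem range_extendW : Set.range (extendW k n) = cochains k n := by
  refine Set.Subset.antisymm (Set.range_subset_iff.2 extendW_mem_cochains) fun f hf => ?_
  refine ⟨f ∘ₗ TensorProduct.mk k _ _ 1 ∘ₗ (TensorProduct.mk k _ _).flip 1,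
    K_hom_ext fun a w a' => ?_⟩
  rw [extendW_tmul, cochains_apply_tmul hf]
  rfl

theorem extendW_injective : Function.Injective (extendW k n) := by
  refine fun h h' e => LinearMap.ext fun w => ?_
  simpa only [extendW_tmul, one_mul, mul_one] using LinearMap.congr_fun e (1 ⊗ₜ (w ⊗ₜ 1))

theorem cochains_apply_tmul_sub_tmul {f : K k n →ₗ[k] A k n} (hf : f ∈ cochains k n) (a : A k n)
    (w : W k n) : f (a ⊗ₜ (w ⊗ₜ 1) - 1 ⊗ₜ (w ⊗ₜ a)) = 0 := by
  rw [map_sub, cochains_apply_tmul hf a, cochains_apply_tmul hf 1 a, mul_one, one_mul, mul_comm,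
    sub_self]

theorem cochains_comp_koszulD {f : K k n →ₗ[k] A k n} (hf : f ∈ cochains k n) :
    f ∘ₗ koszulD k n = 0 := by
  refine K_hom_ext fun a w a' => ?_
  rw [koszulD, LinearMap.comp_apply, LinearMap.comp_apply, LinearMap.lTensor_tmul,
    LinearMap.rTensor_tmul, biact_tmul, hf.1, hf.2, LinearMap.zero_apply]
  convert mul_zero a
  convert zero_mul a'
  refine LinearMap.congr_fun ((basisW k n).ext (f₁ := f ∘ₗ _) (f₂ := 0) fun I => ?_) w
  rw [LinearMap.comp_apply, Module.Basis.constr_basis, map_sum]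
  exact Finset.sum_eq_zero fun l _ => by
    rw [map_smul, cochains_apply_tmul_sub_tmul hf, smul_zero]

/-- The function `b ⊗ w ⊗ b' ↦ b a ⟨l, w⟩ b'` on `K`, where `⟨l, w⟩` is the coefficient of the word
`x_{l_1} ⊗ ⋯ ⊗ x_{l_s}` in `w`. For increasing `l` it is `a` times the function dual to
`o(x_{l_1}, …, x_{l_s})`. -/
noncomputable def dualCochain (a : A k n) (l : List (Fin n)) : K k n →ₗ[k] A k n :=
  extendW k n (a • Algebra.linearMap k (A k n) ∘ₗ coeffW k l)

theorem dualCochain_mem_cochains (a : A k n) (l : List (Fin n)) :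
    dualCochain a l ∈ cochains k n :=
  extendW_mem_cochains _

theorem dualCochain_tmul (a b b' : A k n) (l : List (Fin n)) (w : W k n) :
    dualCochain a l (b ⊗ₜ (w ⊗ₜ b')) = b * (a * MvPolynomial.C (coeffW k l w) * b') := rfl

end

/-! ### The circle product of cochains -/

section

variable {k : Type*} [Field k] {n : ℕ}

theorem sum_ite_take_getElem_drop {α M : Type*} [DecidableEq α] [AddCommMonoid M]
    (I L S : List α) (j : α) (c : M) :
    ∑ r : Fin I.length, (if I.take r = L ∧ I[r] = j ∧ I.drop (r + 1) = S then c else 0) =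
      if I = L ++ j :: S then c else 0 := by
  split_ifs with h
  · subst h
    rw [Finset.sum_eq_single ⟨L.length, by simp⟩]
    · simp
    · refine fun r _ hr => if_neg fun hL => hr (Fin.ext ?_)
      have hlen := congrArg List.length hL.1
      rwa [List.length_take, min_eq_left r.2.le] at hlen
    · exact fun hr => absurd (Finset.mem_univ _) hr
  · refine Finset.sum_eq_zero fun r _ => if_neg ?_
    rintro ⟨rfl, rfl, rfl⟩
    exact h (by simp)

theorem pderiv_prod_map_X {R σ : Type*} [CommSemiring R] [DecidableEq σ] (i : σ) (l : List σ) :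
    MvPolynomial.pderiv i ((l.map MvPolynomial.X).prod : MvPolynomial σ R) =
      ∑ ν : Fin l.length, if i = l[ν] then
        ((l.take ν).map MvPolynomial.X).prod * ((l.drop (ν + 1)).map MvPolynomial.X).prod
      else 0 := by
  induction l with
  | nil => simp
  | cons j l ih =>
    rw [List.map_cons, List.prod_cons, Derivation.leibniz, ih, smul_eq_mul, smul_eq_mul, add_comm]
    simp only [List.length_cons]
    rw [Fin.sum_univ_succ, Finset.mul_sum, MvPolynomial.pderiv_X]
    congr 1
    · simp [Pi.single_apply, eq_comm]
    · exact Finset.sum_congr rfl fun ν _ => by simp [mul_assoc]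

theorem prod_map_X_sort {R σ : Type*} [CommSemiring R] [LinearOrder σ] (m : σ →₀ ℕ) :
    (((Finsupp.toMultiset m).sort.map MvPolynomial.X).prod : MvPolynomial σ R) =
      MvPolynomial.monomial m 1 := by
  rw [← Multiset.prod_coe, ← Multiset.map_coe, Multiset.sort_eq, Finsupp.toMultiset_map,
    Finsupp.prod_toMultiset, MvPolynomial.monomial_eq, map_one, one_mul]
  exact Finsupp.prod_mapDomain_index (fun _ => pow_zero _) fun _ _ _ => pow_add _ _ _

theorem sortedLT_sort_append_cons_sort {α : Type*} [LinearOrder α] {L S : Finset α} {j : α} :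
    (L.sort ++ j :: S.sort).SortedLT ↔ (∀ l ∈ L, l < j) ∧ ∀ i ∈ S, j < i := by
  rw [List.sortedLT_iff_pairwise, List.pairwise_append, List.pairwise_cons]
  simp only [(Finset.sortedLT_sort _).pairwise, true_and, and_true, List.mem_cons,
    Finset.mem_sort]
  constructor
  · rintro ⟨hS, hL⟩
    exact ⟨fun l hl => hL l hl j (Or.inl rfl), hS⟩
  · rintro ⟨hL, hS⟩
    refine ⟨hS, fun l hl i hi => ?_⟩
    rcases hi with rfl | hi
    · exact hL l hl
    · exact (hL l hl).trans (hS i hi)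

theorem dualCochain_phiMonomial_summand {I : List (Fin n)} (hI : I.SortedLT) (a p p' : A k n)
    (S L : Finset (Fin n)) (j : Fin n) (e : ℕ) :
    dualCochain a I (if (∀ l ∈ L, l < j) ∧ (∀ i ∈ S, j < i) then
        (-1 : k) ^ e • (p ⊗ₜ[k] (o k (L.sort ++ j :: S.sort) ⊗ₜ[k] p')) else 0) =
      if I = L.sort ++ j :: S.sort then (-1) ^ e * a * (p * p') else 0 := by
  simp only [← sortedLT_sort_append_cons_sort]
  split_ifs with hs h h
  · rw [map_smul, dualCochain_tmul, coeffW_o_of_sortedLT k hI hs, if_pos h, MvPolynomial.C_1,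
      MvPolynomial.smul_eq_C_mul, map_pow, map_neg, MvPolynomial.C_1]
    ring
  · rw [map_smul, dualCochain_tmul, coeffW_o_of_sortedLT k hI hs, if_neg h, MvPolynomial.C_0,
      mul_zero, zero_mul, mul_zero, smul_zero]
  · exact absurd (h ▸ hI) hs
  · exact map_zero _

theorem dualCochain_phiMonomial {I : List (Fin n)} (hI : I.SortedLT) (a : A k n)
    (S : Finset (Fin n)) (m : Fin n →₀ ℕ) (L : Finset (Fin n)) :
    dualCochain a I (phiMonomial k S m L) =
      ∑ r : Fin I.length, coeffW k (I.drop (r + 1)) (o k S.sort) •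
        coeffW k (I.take r) (o k L.sort) •
          ((-1) ^ ((I.drop (r + 1)).length * r + r) * a *
            MvPolynomial.pderiv (I[r]'r.2) (MvPolynomial.monomial m 1)) := by
  have hdrop (r : ℕ) : (I.drop r).SortedLT := hI.pairwise.drop.sortedLT
  have htake (r : ℕ) : (I.take r).SortedLT := hI.pairwise.take.sortedLT
  simp only [phiMonomial, map_sum, dualCochain_phiMonomial_summand hI,
    ← sum_ite_take_getElem_drop I]
  rw [Finset.sum_comm]
  refine Finset.sum_congr rfl fun r _ => ?_
  rw [← prod_map_X_sort, pderiv_prod_map_X, Finset.mul_sum, Finset.smul_sum, Finset.smul_sum]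
  refine Finset.sum_congr rfl fun ν _ => ?_
  rw [coeffW_o_of_sortedLT k (hdrop _) (Finset.sortedLT_sort S),
    coeffW_o_of_sortedLT k (htake _) (Finset.sortedLT_sort L)]
  split_ifs with h
  · have hr : (r : ℕ) = L.card := by
      rw [← Finset.length_sort (· ≤ ·), ← h.1, List.length_take, min_eq_left r.2.le]
    rw [h.2.2, Finset.length_sort, hr, one_smul, one_smul]
  all_goals simp_all

theorem dualCochain_phiGen {I : List (Fin n)} (hI : I.SortedLT) (a c : A k n) (w w' : W k n) :
    dualCochain a I (phiGen k n w c w') =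
      ∑ r : Fin I.length, coeffW k (I.drop (r + 1)) w • coeffW k (I.take r) w' •
        ((-1) ^ ((I.drop (r + 1)).length * r + r) * a * MvPolynomial.pderiv (I[r]'r.2) c) := by
  let T (r : Fin I.length) : W k n →ₗ[k] A k n →ₗ[k] W k n →ₗ[k] A k n :=
    (coeffW k (I.drop (r + 1))).smulRight ((coeffW k (I.take r)).smulRight
      (LinearMap.mulLeft k ((-1) ^ ((I.drop (r + 1)).length * r + r) * a) ∘ₗ
        (MvPolynomial.pderiv (I[r]'r.2)).toLinearMap)).flip
  have h : (phiGen k n).compr₂ (LinearMap.compRight k (dualCochain a I)) = ∑ r, T r := by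
    refine (basisW k n).ext fun S => (MvPolynomial.basisMonomials (Fin n) k).ext fun m =>
      (basisW k n).ext fun L => ?_
    simp only [LinearMap.sum_apply]
    refine Eq.trans ?_ ((dualCochain_phiMonomial hI a S m L).trans ?_)
    · rw [LinearMap.compr₂_apply, LinearMap.compRight_apply, LinearMap.comp_apply, phiGen,
        Module.Basis.constr_basis, Module.Basis.constr_basis, Module.Basis.constr_basis]
    · simp only [basisW_apply, MvPolynomial.coe_basisMonomials]
      rfl
  refine (LinearMap.congr_fun₂ (LinearMap.congr_fun h w) c w').trans ?_
  simp only [LinearMap.sum_apply]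
  rfl

end

section

variable (k : Type*) [Field k] {n : ℕ}

variable (n) in
/-- The iterated coproduct `w ↦ ∑ w_1 ⊗ w_2 ⊗ w_3` of `W`. -/
noncomputable def comulW₂ : W k n →ₗ[k] W k n ⊗[k] (W k n ⊗[k] W k n) :=
  (TensorProduct.assoc k (W k n) (W k n) (W k n)).toLinearMap ∘ₗ
    LinearMap.rTensor (W k n) (comulW k n) ∘ₗ comulW k n

theorem dualDistrib_assoc {R M N P : Type*} [CommSemiring R] [AddCommMonoid M] [Module R M]
    [AddCommMonoid N] [Module R N] [AddCommMonoid P] [Module R P] (f : Module.Dual R M)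
    (g : Module.Dual R N) (h : Module.Dual R P) (z : (M ⊗[R] N) ⊗[R] P) :
    TensorProduct.dualDistrib R M (N ⊗[R] P) (f ⊗ₜ TensorProduct.dualDistrib R N P (g ⊗ₜ h))
        (TensorProduct.assoc R M N P z) =
      TensorProduct.dualDistrib R (M ⊗[R] N) P
        (TensorProduct.dualDistrib R M N (f ⊗ₜ g) ⊗ₜ h) z := by
  suffices e : TensorProduct.dualDistrib R M (N ⊗[R] P)
        (f ⊗ₜ TensorProduct.dualDistrib R N P (g ⊗ₜ h)) ∘ₗ
          (TensorProduct.assoc R M N P).toLinearMap =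
      TensorProduct.dualDistrib R (M ⊗[R] N) P (TensorProduct.dualDistrib R M N (f ⊗ₜ g) ⊗ₜ h) from
    LinearMap.congr_fun e z
  exact TensorProduct.ext_threefold fun x y z => (mul_assoc (f x) (g y) (h z)).symm

theorem dualDistrib_coeffW_comulW₂ (l l' l'' : List (Fin n)) (w : W k n) :
    TensorProduct.dualDistrib k _ _ (coeffW k l ⊗ₜ
        TensorProduct.dualDistrib k _ _ (coeffW k l' ⊗ₜ coeffW k l'')) (comulW₂ k n w) =
      coeffW k (l ++ l' ++ l'') w := by
  have hcomul : TensorProduct.dualDistrib k _ _ (coeffW k l ⊗ₜ coeffW k l') ∘ₗ comulW k n =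
      coeffW k (l ++ l') :=
    LinearMap.ext (dualDistrib_coeffW_comulW k l l')
  simp only [comulW₂, LinearMap.comp_apply, LinearEquiv.coe_coe]
  rw [dualDistrib_assoc, LinearMap.rTensor, dualDistrib_map, hcomul, LinearMap.comp_id,
    dualDistrib_coeffW_comulW]

variable {k}

/-- The map `w_1 ⊗ w_2 ⊗ w_3 ↦ a ⊗ w_1 ⊗ 1 ⊗ w_2 ⊗ 1 ⊗ w_3 ⊗ a'` into `K ⊗_A K ⊗_A K`. -/
noncomputable def insertOnes (a a' : A k n) : W k n ⊗[k] (W k n ⊗[k] W k n) →ₗ[k] KKK k n :=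
  TensorProduct.mk k (A k n) _ a ∘ₗ
    LinearMap.lTensor (W k n) (TensorProduct.mk k (A k n) _ 1 ∘ₗ
      LinearMap.lTensor (W k n) (TensorProduct.mk k (A k n) _ 1 ∘ₗ
        (TensorProduct.mk k (W k n) (A k n)).flip a'))

theorem comulTensor_tmul {X : Type*} [AddCommMonoid X] [Module k X] (a : A k n) (w : W k n)
    (x : X) :
    comulTensor k n X (a ⊗ₜ (w ⊗ₜ x)) =
      a ⊗ₜ LinearMap.lTensor (W k n)
        (TensorProduct.mk k (A k n) (W k n ⊗[k] X) 1 ∘ₗ (TensorProduct.mk k (W k n) X).flip x)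
        (comulW k n w) := by
  change a ⊗ₜ (LinearMap.lTensor (W k n) (TensorProduct.mk k (A k n) (W k n ⊗[k] X) 1)
    (TensorProduct.assoc k (W k n) (W k n) X (comulW k n w ⊗ₜ x))) = _
  congr 1
  induction comulW k n w with
  | zero => simp only [TensorProduct.zero_tmul, map_zero]
  | add y z hy hz => simp only [TensorProduct.add_tmul, map_add, hy, hz]
  | tmul w₁ w₂ => rfl

theorem comulK₂_tmul (a a' : A k n) (w : W k n) :
    comulK₂ k n (a ⊗ₜ (w ⊗ₜ a')) = insertOnes a a' (comulW₂ k n w) := by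
  simp only [comulK₂, comulK, comulW₂, LinearMap.comp_apply, comulTensor_tmul]
  induction comulW k n w with
  | zero => simp only [map_zero, TensorProduct.tmul_zero]
  | add x y hx hy => simp only [map_add, TensorProduct.tmul_add, hx, hy]
  | tmul w₁ w₂ =>
    simp only [LinearMap.lTensor_tmul, LinearMap.rTensor_tmul, LinearMap.comp_apply,
      LinearMap.flip_apply, TensorProduct.mk_apply, comulTensor_tmul]
    induction comulW k n w₁ with
    | zero => simp only [map_zero, TensorProduct.tmul_zero, TensorProduct.zero_tmul]
    | add x y hx hy => simp only [map_add, TensorProduct.tmul_add, TensorProduct.add_tmul, hx, hy]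
    | tmul w₁ w₂ => rfl

theorem idTensorId_insertOnes_tmul (q : ℕ) (g : K k n →ₗ[k] A k n) (a a' : A k n)
    (w₁ w₂ w₃ : W k n) :
    idTensorId q g (insertOnes a a' (w₁ ⊗ₜ (w₂ ⊗ₜ w₃))) =
      a ⊗ₜ (signW k n q w₁ ⊗ₜ (g (1 ⊗ₜ (w₂ ⊗ₜ 1)) ⊗ₜ (w₃ ⊗ₜ a'))) := by
  rw [← mul_one (g _)]
  rfl

theorem phi_tmul (a c a' : A k n) (w w' : W k n) :
    phi k n (a ⊗ₜ (w ⊗ₜ (c ⊗ₜ (w' ⊗ₜ a')))) =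
      lact k n a (ract k n a' (phiGen k n w c w')) := rfl

theorem dualCochain_phi_insertOnes_tmul {I : List (Fin n)} (hI : I.SortedLT) (J : List (Fin n))
    (q : ℕ) (a b c c' : A k n) (w₁ w₂ w₃ : W k n) :
    dualCochain a I (phi k n (idTensorId q (dualCochain b J)
        (insertOnes c c' (w₁ ⊗ₜ (w₂ ⊗ₜ w₃))))) =
      ∑ r : Fin I.length,
        (coeffW k (I.drop (r + 1)) w₁ * (coeffW k J w₂ * coeffW k (I.take r) w₃)) •
          ((-1) ^ ((I.drop (r + 1)).length * (q + r) + r) *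
            (c * (a * MvPolynomial.pderiv (I[r]'r.2) b * c'))) := by
  have hf := dualCochain_mem_cochains a I
  have hg : dualCochain b J (1 ⊗ₜ (w₂ ⊗ₜ 1)) = coeffW k J w₂ • b := by
    rw [dualCochain_tmul, one_mul, mul_one, MvPolynomial.smul_eq_C_mul, mul_comm]
  rw [idTensorId_insertOnes_tmul, phi_tmul, hf.1, hf.2, dualCochain_phiGen hI, hg,
    Finset.sum_mul, Finset.mul_sum]
  refine Finset.sum_congr rfl fun r _ => ?_
  rw [coeffW_signW, Derivation.map_smul]
  simp only [MvPolynomial.smul_eq_C_mul, map_mul, map_pow, map_neg, map_one]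
  ring

theorem dualCochain_phi_insertOnes {I : List (Fin n)} (hI : I.SortedLT) (J : List (Fin n))
    (q : ℕ) (a b c c' : A k n) (t : W k n ⊗[k] (W k n ⊗[k] W k n)) :
    dualCochain a I (phi k n (idTensorId q (dualCochain b J) (insertOnes c c' t))) =
      ∑ r : Fin I.length, TensorProduct.dualDistrib k _ _ (coeffW k (I.drop (r + 1)) ⊗ₜ
          TensorProduct.dualDistrib k _ _ (coeffW k J ⊗ₜ coeffW k (I.take r))) t •
        ((-1) ^ ((I.drop (r + 1)).length * (q + r) + r) *
          (c * (a * MvPolynomial.pderiv (I[r]'r.2) b * c'))) := by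
  induction t with
  | zero => simp only [map_zero, zero_smul, Finset.sum_const_zero]
  | add x y hx hy => simp only [map_add, add_smul, Finset.sum_add_distrib, hx, hy]
  | tmul w₁ t =>
    induction t with
    | zero => simp only [TensorProduct.tmul_zero, map_zero, zero_smul, Finset.sum_const_zero]
    | add x y hx hy =>
      simp only [TensorProduct.tmul_add, map_add, add_smul, Finset.sum_add_distrib, hx, hy]
    | tmul w₂ w₃ => exact dualCochain_phi_insertOnes_tmul hI J q a b c c' w₁ w₂ w₃

theorem circ_dualCochain {I : List (Fin n)} (hI : I.SortedLT) (J : List (Fin n)) (a b : A k n) :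
    circ J.length (dualCochain a I) (dualCochain b J) =
      ∑ r : Fin I.length, (-1 : ℤ) ^ ((I.drop (r + 1)).length * (J.length + r) + r) •
        dualCochain (a * MvPolynomial.pderiv (I[r]'r.2) b) (I.drop (r + 1) ++ J ++ I.take r) := by
  refine K_hom_ext fun c w c' => ?_
  simp only [circ, LinearMap.comp_apply]
  rw [comulK₂_tmul, dualCochain_phi_insertOnes hI, LinearMap.sum_apply]
  refine Finset.sum_congr rfl fun r _ => ?_
  rw [dualDistrib_coeffW_comulW₂, LinearMap.smul_apply, dualCochain_tmul,
    MvPolynomial.smul_eq_C_mul, zsmul_eq_mul]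
  push_cast
  ring

end

/-! ### Contraction and graded commutativity -/

section Contraction

variable {R M : Type*} [CommRing R] [AddCommGroup M] [Module R M] {Q : QuadraticForm R M}

theorem contractLeft_mul (d : Module.Dual R M) (x y : CliffordAlgebra Q) :
    CliffordAlgebra.contractLeft d (x * y) = CliffordAlgebra.contractLeft d x * y +
      CliffordAlgebra.involute x * CliffordAlgebra.contractLeft d y := by
  induction x using CliffordAlgebra.left_induction with
  | algebraMap r =>
    rw [CliffordAlgebra.contractLeft_algebraMap_mul, CliffordAlgebra.contractLeft_algebraMap,
      AlgHom.commutes, zero_mul, zero_add]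
  | add x₁ x₂ h₁ h₂ =>
    simp only [add_mul, map_add, h₁, h₂]
    abel
  | ι_mul x m hx =>
    rw [mul_assoc, CliffordAlgebra.contractLeft_ι_mul, CliffordAlgebra.contractLeft_ι_mul, hx,
      map_mul, CliffordAlgebra.involute_ι, sub_mul, smul_mul_assoc, mul_add, neg_mul, neg_mul,
      mul_assoc, mul_assoc]
    abel

theorem contractRight_eq_neg_contractLeft_involute (d : Module.Dual R M) (x : CliffordAlgebra Q) :
    CliffordAlgebra.contractRight x d =
      -CliffordAlgebra.contractLeft d (CliffordAlgebra.involute x) := by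
  induction x using CliffordAlgebra.right_induction with
  | algebraMap r =>
    rw [CliffordAlgebra.contractRight_algebraMap, AlgHom.commutes,
      CliffordAlgebra.contractLeft_algebraMap, neg_zero]
  | add x₁ x₂ h₁ h₂ =>
    simp only [map_add, LinearMap.add_apply, h₁, h₂]
    abel
  | mul_ι m x hx =>
    rw [CliffordAlgebra.contractRight_mul_ι, hx, map_mul, CliffordAlgebra.involute_ι,
      contractLeft_mul, CliffordAlgebra.involute_involute, map_neg,
      CliffordAlgebra.contractLeft_ι, mul_neg, mul_neg, ← Algebra.commutes, ← Algebra.smul_def,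
      neg_mul]
    abel

theorem contractRight_mul (d : Module.Dual R M) (x y : CliffordAlgebra Q) :
    CliffordAlgebra.contractRight (x * y) d = x * CliffordAlgebra.contractRight y d +
      CliffordAlgebra.contractRight x d * CliffordAlgebra.involute y := by
  simp only [contractRight_eq_neg_contractLeft_involute]
  rw [map_mul, contractLeft_mul, CliffordAlgebra.involute_involute, neg_mul, mul_neg]
  abel

theorem ι_mul_eq_involute_mul_ι (m : M) (x : ExteriorAlgebra R M) :
    ExteriorAlgebra.ι R m * x = CliffordAlgebra.involute x * ExteriorAlgebra.ι R m := by
  induction x using ExteriorAlgebra.induction with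
  | algebraMap r => rw [AlgHom.commutes, Algebra.commutes]
  | ι m' =>
    rw [ExteriorAlgebra.ι, CliffordAlgebra.involute_ι, neg_mul]
    exact eq_neg_of_add_eq_zero_left (ExteriorAlgebra.ι_add_mul_swap _ _)
  | mul x y hx hy => rw [← mul_assoc, hx, mul_assoc, hy, map_mul, mul_assoc]
  | add x y hx hy => rw [mul_add, hx, hy, map_add, add_mul]

theorem involute_of_mem_exteriorPower {p : ℕ} {x : ExteriorAlgebra R M} (hx : x ∈ ⋀[R]^p M) :
    CliffordAlgebra.involute x = (-1 : ℤ) ^ p • x := by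
  induction hx using Submodule.pow_induction_on_left' with
  | algebraMap r => rw [AlgHom.commutes, pow_zero, one_smul]
  | add x y p _ _ hx hy => rw [map_add, hx, hy, smul_add]
  | mem_mul m hm p x _ ih =>
    obtain ⟨m, rfl⟩ := hm
    rw [map_mul, ih, ExteriorAlgebra.ι, CliffordAlgebra.involute_ι, neg_mul, mul_smul_comm,
      Nat.succ_eq_add_one, pow_succ, mul_neg_one, neg_smul]

theorem mul_comm_of_mem_exteriorPower {p q : ℕ} {x y : ExteriorAlgebra R M}
    (hx : x ∈ ⋀[R]^p M) (hy : y ∈ ⋀[R]^q M) : x * y = (-1 : ℤ) ^ (p * q) • (y * x) := by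
  induction hx using Submodule.pow_induction_on_left' with
  | algebraMap r => rw [Algebra.commutes, zero_mul, pow_zero, one_smul]
  | add x x' p _ _ hx hx' => rw [add_mul, mul_add, hx, hx', smul_add]
  | mem_mul m hm p x _ ih =>
    obtain ⟨m, rfl⟩ := hm
    rw [mul_assoc, ih, mul_smul_comm, ← mul_assoc, ι_mul_eq_involute_mul_ι,
      involute_of_mem_exteriorPower hy, smul_mul_assoc, smul_mul_assoc, smul_smul,
      mul_assoc, ← pow_add, Nat.succ_mul]

theorem contractLeft_mem_exteriorPower (d : Module.Dual R M) {p : ℕ} {x : ExteriorAlgebra R M}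
    (hx : x ∈ ⋀[R]^p M) : CliffordAlgebra.contractLeft d x ∈ ⋀[R]^(p - 1) M := by
  induction hx using Submodule.pow_induction_on_left' with
  | algebraMap r =>
    rw [CliffordAlgebra.contractLeft_algebraMap]
    exact Submodule.zero_mem _
  | add x y p _ _ hx hy =>
    rw [map_add]
    exact Submodule.add_mem _ hx hy
  | mem_mul m hm p x hx ih =>
    obtain ⟨m, rfl⟩ := hm
    rw [ExteriorAlgebra.ι, CliffordAlgebra.contractLeft_ι_mul]
    refine Submodule.sub_mem _ (Submodule.smul_mem _ _ hx) ?_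
    cases p with
    | zero =>
      obtain ⟨r, rfl⟩ := Submodule.mem_one.1 hx
      rw [CliffordAlgebra.contractLeft_algebraMap, mul_zero]
      exact Submodule.zero_mem _
    | succ p =>
      change _ ∈ LinearMap.range (ExteriorAlgebra.ι R) ^ (p + 1)
      rw [pow_succ']
      exact Submodule.mul_mem_mul ⟨m, rfl⟩ ih

theorem contractLeft_mul_comm_of_mem_exteriorPower (d : Module.Dual R M) {p q : ℕ}
    {x y : ExteriorAlgebra R M} (hx : x ∈ ⋀[R]^p M) (hy : y ∈ ⋀[R]^q M) :
    CliffordAlgebra.contractLeft d x * y =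
      (-1 : ℤ) ^ ((p + 1) * q) • (y * CliffordAlgebra.contractLeft d x) := by
  cases p with
  | zero =>
    obtain ⟨r, rfl⟩ := Submodule.mem_one.1 hx
    rw [CliffordAlgebra.contractLeft_algebraMap, zero_mul, mul_zero, smul_zero]
  | succ p =>
    rw [mul_comm_of_mem_exteriorPower (contractLeft_mem_exteriorPower d hx) hy,
      Nat.add_sub_cancel, add_assoc, one_add_one_eq_two, add_mul, pow_add,
      (even_two.mul_right q).neg_one_pow, mul_one]

theorem contractRight_eq_of_mem_exteriorPower (d : Module.Dual R M) {p : ℕ}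
    {x : ExteriorAlgebra R M} (hx : x ∈ ⋀[R]^p M) :
    CliffordAlgebra.contractRight x d = (-1 : ℤ) ^ (p + 1) • CliffordAlgebra.contractLeft d x := by
  rw [contractRight_eq_neg_contractLeft_involute, involute_of_mem_exteriorPower hx, map_zsmul,
    pow_succ, mul_neg_one, neg_smul]

theorem contractRight_mul_comm_of_mem_exteriorPower (d : Module.Dual R M) {p q : ℕ}
    {x y : ExteriorAlgebra R M} (hx : x ∈ ⋀[R]^p M) (hy : y ∈ ⋀[R]^q M) :
    CliffordAlgebra.contractRight x d * y =
      (-1 : ℤ) ^ ((p + 1) * q) • (y * CliffordAlgebra.contractRight x d) := by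
  rw [contractRight_eq_of_mem_exteriorPower d hx, smul_mul_assoc, mul_smul_comm, smul_comm,
    contractLeft_mul_comm_of_mem_exteriorPower d hx hy]

end Contraction

/-! ### Polyvector fields as cochains -/

section

variable (k : Type*) [Field k] {n : ℕ}

theorem delList_nil : delList k ([] : List (Fin n)) = 1 := rfl

theorem delList_cons (i : Fin n) (l : List (Fin n)) :
    delList k (i :: l) = del k i * delList k l :=
  List.prod_cons

theorem delList_singleton (i : Fin n) : delList k [i] = del k i := List.prod_singleton

theorem delList_append (l l' : List (Fin n)) :
    delList k (l ++ l') = delList k l * delList k l' := by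
  rw [delList, List.map_append, List.prod_append]
  rfl

theorem delList_eq_ιMulti (l : List (Fin n)) : delList k l =
    ExteriorAlgebra.ιMulti (A k n) l.length fun j => Pi.single (l[j]'j.2) 1 := by
  rw [ExteriorAlgebra.ιMulti_apply, delList, ← List.ofFn_getElem_eq_map]
  rfl

theorem delList_mem (l : List (Fin n)) : delList k l ∈ ⋀[A k n]^l.length (Fin n → A k n) := by
  rw [delList_eq_ιMulti]
  exact ExteriorAlgebra.ιMulti_range _ _ ⟨_, rfl⟩

theorem smul_delList_mem (a : A k n) (l : List (Fin n)) :
    a • delList k l ∈ ⋀[A k n]^l.length (Fin n → A k n) :=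
  Submodule.smul_mem _ _ (delList_mem k l)

theorem delList_append_comm (l l' : List (Fin n)) :
    delList k (l ++ l') = (-1 : ℤ) ^ (l.length * l'.length) • delList k (l' ++ l) := by
  rw [delList_append, delList_append,
    mul_comm_of_mem_exteriorPower (delList_mem k l) (delList_mem k l')]

theorem delList_reverse (l : List (Fin n)) :
    delList k l.reverse = (-1 : ℤ) ^ (l.length * (l.length - 1) / 2) • delList k l := by
  induction l with
  | nil => rw [List.reverse_nil, List.length_nil, zero_mul, Nat.zero_div, pow_zero, one_smul]
  | cons i l ih =>
    rw [List.reverse_cons, delList_append_comm, List.length_reverse, List.length_singleton,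
      mul_one, delList_append, ih, delList_singleton, mul_smul_comm, ← delList_cons, smul_smul,
      ← pow_add, List.length_cons, Nat.triangle_succ, add_comm]

theorem coeffW_o_sort_eq_det (I : Finset (Fin n)) (l : List (Fin n)) (h : I.card = l.length) :
    coeffW k l (o k I.sort) = (Matrix.of fun i j : Fin l.length =>
      if I.orderEmbOfFin h i = l[j]'j.2 then (1 : k) else 0).det := by
  rw [coeffW, LinearMap.comp_apply, Submodule.subtype_apply, o_sort_coe k n I h, orbitSum,
    MultilinearMap.alternatization_apply, map_sum, map_sum, Matrix.det_apply]
  refine Finset.sum_congr rfl fun σ _ => ?_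
  rw [map_zsmul_unit, map_zsmul_unit, MultilinearMap.domDomCongr_apply, coeffList_lof_tprod]
  simp only [MvPolynomial.coeff_X, Finsupp.single_left_inj one_ne_zero, Matrix.of_apply]

theorem polyvectorCoeff_delList (I : Finset (Fin n)) (l : List (Fin n)) :
    polyvectorCoeff k I (delList k l) =
      (-1) ^ (l.length * (l.length - 1) / 2) * MvPolynomial.C (coeffW k l (o k I.sort)) := by
  rw [delList_eq_ιMulti, polyvectorCoeff, ExteriorAlgebra.liftAlternating_apply_ιMulti]
  split_ifs with h
  · rw [AlternatingMap.smul_apply, smul_eq_mul, AlternatingMap.compLinearMap_apply,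
      coeffW_o_sort_eq_det k I l h, ← Matrix.det_transpose, RingHom.map_det]
    refine congrArg (_ * Matrix.det ·) (Matrix.ext fun i j => ?_)
    simp [Pi.single_apply, Matrix.transpose_apply, apply_ite, LinearMap.funLeft_apply]
  · rw [coeffW_o_of_length_ne k (by rwa [Finset.length_sort, ne_comm]), map_zero, mul_zero,
      AlternatingMap.zero_apply]

/- The sign `(-1)^{1+⋯+(s-1)}` in the isomorphism with the cochains is the sign of the reversal of
a word of length `s`, so it is absorbed by the words `l.reverse`. -/
theorem polyvectorCoeff_delList_reverse (I : Finset (Fin n)) (l : List (Fin n)) :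
    polyvectorCoeff k I (delList k l.reverse) = MvPolynomial.C (coeffW k l (o k I.sort)) := by
  rw [delList_reverse, map_zsmul, polyvectorCoeff_delList, zsmul_eq_mul, ← mul_assoc]
  push_cast
  rw [← mul_pow, neg_one_mul, neg_neg, one_pow, one_mul]

theorem toCochain_smul_delList_reverse (a : A k n) (l : List (Fin n)) :
    toCochain k n (a • delList k l.reverse) = dualCochain a l := by
  rw [map_smul, dualCochain, map_smul, toCochain, LinearMap.comp_apply, LinearMap.comp_apply]
  congr 2
  refine (basisW k n).ext fun I => ?_
  rw [LinearEquiv.coe_coe, Module.Basis.constr_basis, LinearMap.pi_apply,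
    polyvectorCoeff_delList_reverse, basisW_apply]
  rfl

variable (n) in
/-- The basis of `A[∂_1, …, ∂_n]` consisting of the `∂_{i_s} ⋯ ∂_{i_1}`, `i_1 < ⋯ < i_s`. -/
noncomputable def basisPolyvector : Module.Basis (Finset (Fin n)) (A k n) (Polyvector k n) :=
  (Pi.basisFun (A k n) (Fin n)).ExteriorAlgebra.unitsSMul fun I =>
    (-1) ^ (I.card * (I.card - 1) / 2)

theorem basisPolyvector_apply (I : Finset (Fin n)) :
    basisPolyvector k n I = delList k I.sort.reverse := by
  have h : (Pi.basisFun (A k n) (Fin n)).ExteriorAlgebra I = delList k I.sort := by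
    rw [ExteriorAlgebra.basis_apply_ofCard _ (Finset.length_sort (· ≤ ·)).symm, delList_eq_ιMulti]
    exact congrArg _ (funext fun j => Pi.basisFun_apply _ _ _)
  rw [basisPolyvector, Module.Basis.unitsSMul_apply, h, delList_reverse, Finset.length_sort,
    Units.smul_def, ← Int.cast_smul_eq_zsmul (A k n)]
  push_cast
  rfl

theorem pi_polyvectorCoeff :
    LinearMap.pi (polyvectorCoeff k) = (basisPolyvector k n).equivFun.toLinearMap := by
  refine (basisPolyvector k n).ext fun J => funext fun I => ?_
  rw [LinearEquiv.coe_coe, Module.Basis.equivFun_self, basisPolyvector_apply, LinearMap.pi_apply,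
    polyvectorCoeff_delList_reverse, coeffW_sort_o_sort, apply_ite MvPolynomial.C, map_one,
    map_zero]

theorem toCochain_injective : Function.Injective (toCochain k n) := by
  rw [toCochain, pi_polyvectorCoeff]
  exact extendW_injective.comp
    (((basisW k n).constr (A k n)).injective.comp (basisPolyvector k n).equivFun.injective)

theorem range_toCochain : Set.range (toCochain k n) = cochains k n := by
  rw [toCochain, pi_polyvectorCoeff, ← range_extendW]
  exact (((basisW k n).constr (A k n)).surjective.comp
    (basisPolyvector k n).equivFun.surjective).range_comp (extendW k n)

theorem exteriorPower_eq_span_delList (p : ℕ) : ⋀[A k n]^p (Fin n → A k n) =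
    Submodule.span (A k n) {x | ∃ l : List (Fin n), l.length = p ∧ delList k l = x} := by
  have h : LinearMap.range (ExteriorAlgebra.ι (A k n)) =
      Submodule.span (A k n) (Set.range (del k : Fin n → Polyvector k n)) := by
    rw [LinearMap.range_eq_map, ← (Pi.basisFun (A k n) (Fin n)).span_eq, Submodule.map_span,
      ← Set.range_comp]
    exact congrArg _ (congrArg _ (funext fun i => congrArg _ (Pi.basisFun_apply _ _ _)))
  change LinearMap.range (ExteriorAlgebra.ι (A k n)) ^ p = _
  rw [h, Submodule.span_pow]
  congr 1
  ext x
  rw [Set.mem_pow]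
  constructor
  · rintro ⟨f, rfl⟩
    choose g hg using fun i => (f i).2
    refine ⟨List.ofFn g, List.length_ofFn, ?_⟩
    rw [delList, List.map_ofFn]
    exact congrArg (List.prod ∘ List.ofFn) (funext hg)
  · rintro ⟨l, rfl, rfl⟩
    refine ⟨fun i => ⟨del k l[i], l[i], rfl⟩, ?_⟩
    exact congrArg List.prod (List.ofFn_getElem_eq_map l (del k))

variable {k}

theorem polyvector_induction {P : Polyvector k n → Prop}
    (add : ∀ x y, P x → P y → P (x + y))
    (smul_delList : ∀ (a : A k n) (l : List (Fin n)), l.SortedLT → P (a • delList k l.reverse))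
    (x : Polyvector k n) : P x := by
  rw [← (basisPolyvector k n).sum_repr x]
  refine Finset.sum_induction _ P add ?_ fun I _ => ?_
  · simpa only [zero_smul] using smul_delList 0 [] List.Pairwise.nil.sortedLT
  · rw [basisPolyvector_apply]
    exact smul_delList _ _ (Finset.sortedLT_sort I)

theorem exteriorPower_induction {p : ℕ}
    {P : (x : Polyvector k n) → x ∈ ⋀[A k n]^p (Fin n → A k n) → Prop}
    (zero : P 0 (Submodule.zero_mem _))
    (add : ∀ x y hx hy, P x hx → P y hy → P (x + y) (Submodule.add_mem _ hx hy))
    (smul_delList : ∀ (a : A k n) (l : List (Fin n)) (hl : l.length = p),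
      P (a • delList k l) (hl ▸ smul_delList_mem k a l))
    {x : Polyvector k n} (hx : x ∈ ⋀[A k n]^p (Fin n → A k n)) : P x hx := by
  suffices h : ∀ y (hy : y ∈ Submodule.span (A k n) {x | ∃ l, l.length = p ∧ delList k l = x}),
      P y (exteriorPower_eq_span_delList k p ▸ hy) from
    h x (exteriorPower_eq_span_delList k p ▸ hx)
  intro y hy
  induction hy using Submodule.closure_induction with
  | zero => exact zero
  | add x y _ _ hx hy => exact add x y _ _ hx hy
  | smul_mem a x hx =>
    obtain ⟨l, hl, rfl⟩ := hx
    exact smul_delList a l hl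

end

/-! ### The Schouten–Nijenhuis bracket -/

section

variable (k : Type*) [Field k] {n : ℕ}

/-- The derivation `∂/∂x_i` acting on the coefficients of a polyvector field. -/
noncomputable def coeffDeriv (i : Fin n) : Polyvector k n →ₗ[k] Polyvector k n :=
  ((basisPolyvector k n).equivFun.symm.toLinearMap.restrictScalars k) ∘ₗ
    (LinearMap.pi fun I => (MvPolynomial.pderiv i).toLinearMap ∘ₗ LinearMap.proj I) ∘ₗ
    ((basisPolyvector k n).equivFun.toLinearMap.restrictScalars k)

theorem coeffDeriv_smul_delList (i : Fin n) (a : A k n) (l : List (Fin n)) :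
    coeffDeriv k i (a • delList k l) = MvPolynomial.pderiv i a • delList k l := by
  have coord (b : A k n) (I : Finset (Fin n)) : (basisPolyvector k n).equivFun (b • delList k l) I =
      MvPolynomial.C (coeffW k l.reverse (o k I.sort)) * b := by
    rw [← LinearEquiv.coe_coe, ← pi_polyvectorCoeff, LinearMap.pi_apply, map_smul, smul_eq_mul,
      mul_comm, ← polyvectorCoeff_delList_reverse, List.reverse_reverse]
  refine (basisPolyvector k n).equivFun.injective (funext fun I => ?_)
  simp only [coeffDeriv, LinearMap.comp_apply, LinearMap.restrictScalars_apply,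
    LinearEquiv.coe_coe, LinearEquiv.apply_symm_apply, LinearMap.pi_apply, LinearMap.proj_apply,
    coord]
  exact MvPolynomial.pderiv_C_mul

theorem coeffDeriv_mul (i : Fin n) (x y : Polyvector k n) :
    coeffDeriv k i (x * y) = coeffDeriv k i x * y + x * coeffDeriv k i y := by
  induction x using polyvector_induction with
  | add x x' hx hx' =>
    simp only [add_mul, map_add, hx, hx']
    abel
  | smul_delList a I =>
    induction y using polyvector_induction with
    | add y y' hy hy' =>
      simp only [mul_add, map_add, hy, hy']
      abel
    | smul_delList b J =>
      rw [smul_mul_smul_comm, ← delList_append]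
      simp only [coeffDeriv_smul_delList]
      rw [smul_mul_smul_comm, smul_mul_smul_comm, ← delList_append, ← add_smul,
        Derivation.leibniz, smul_eq_mul, smul_eq_mul, mul_comm b, add_comm]

theorem coeffDeriv_mem {p : ℕ} (i : Fin n) {x : Polyvector k n}
    (hx : x ∈ ⋀[A k n]^p (Fin n → A k n)) : coeffDeriv k i x ∈ ⋀[A k n]^p (Fin n → A k n) := by
  induction hx using exteriorPower_induction with
  | zero =>
    rw [map_zero]
    exact Submodule.zero_mem _
  | add x y _ _ hx hy =>
    rw [map_add]
    exact Submodule.add_mem _ hx hy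
  | smul_delList a l hl =>
    rw [coeffDeriv_smul_delList, ← hl]
    exact smul_delList_mem k _ l

theorem contractRight_delList (i : Fin n) (l : List (Fin n)) :
    CliffordAlgebra.contractRight (delList k l) (LinearMap.proj i) = ∑ r : Fin l.length,
      if l[r]'r.2 = i then
        (-1 : ℤ) ^ (l.drop (r + 1)).length • delList k (l.take r ++ l.drop (r + 1))
      else 0 := by
  induction l with
  | nil =>
    rw [delList_nil, CliffordAlgebra.contractRight_one]
    rfl
  | cons j l ih =>
    have hj : CliffordAlgebra.contractRight (del k j) (LinearMap.proj i) =
        if j = i then 1 else 0 := by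
      rw [del, ExteriorAlgebra.ι, CliffordAlgebra.contractRight_ι, LinearMap.proj_apply,
        Pi.single_apply, apply_ite (algebraMap _ _), map_one, map_zero]
      exact if_congr eq_comm rfl rfl
    rw [delList_cons, contractRight_mul, ih, hj, involute_of_mem_exteriorPower (delList_mem k l),
      add_comm, Finset.mul_sum]
    refine Eq.trans ?_ (Fin.sum_univ_succ _).symm
    congr 1
    · rw [ite_mul, one_mul, zero_mul]
      rfl
    · refine Finset.sum_congr rfl fun r _ => ?_
      rw [mul_ite, mul_zero, mul_smul_comm, ← delList_cons]
      rfl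

variable (n) in
/-- The operation `ω, η ↦ ∑_i (ω ⌊ dx_i) · ∂η/∂x_i` on polyvector fields, which corresponds to
`∘_φ` on cochains. -/
noncomputable def circPoly : Polyvector k n →ₗ[k] Polyvector k n →ₗ[k] Polyvector k n :=
  ∑ i, (LinearMap.mul k (Polyvector k n)).compl₁₂
    ((CliffordAlgebra.contractRight.flip (LinearMap.proj i)).restrictScalars k) (coeffDeriv k i)

variable (n) in
/-- The Schouten–Nijenhuis bracket
`ω, η ↦ ∑_i ((ω ⌊ dx_i) · ∂η/∂x_i - ∂ω/∂x_i · (dx_i ⌋ η))`. -/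
noncomputable def schouten : Polyvector k n →ₗ[k] Polyvector k n →ₗ[k] Polyvector k n :=
  circPoly k n - ∑ i, (LinearMap.mul k (Polyvector k n)).compl₁₂ (coeffDeriv k i)
    ((CliffordAlgebra.contractLeft (LinearMap.proj i)).restrictScalars k)

theorem circPoly_apply (x y : Polyvector k n) : circPoly k n x y =
    ∑ i, CliffordAlgebra.contractRight x (LinearMap.proj i) * coeffDeriv k i y := by
  simp only [circPoly, LinearMap.sum_apply]
  rfl

theorem schouten_apply (x y : Polyvector k n) : schouten k n x y =
    ∑ i, (CliffordAlgebra.contractRight x (LinearMap.proj i) * coeffDeriv k i y -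
      coeffDeriv k i x * CliffordAlgebra.contractLeft (LinearMap.proj i) y) := by
  rw [schouten, LinearMap.sub_apply, LinearMap.sub_apply, circPoly_apply, Finset.sum_sub_distrib]
  simp only [LinearMap.sum_apply]
  rfl

theorem circPoly_smul_delList (a b : A k n) (I J : List (Fin n)) :
    circPoly k n (a • delList k I) (b • delList k J) = ∑ r : Fin I.length,
      (-1 : ℤ) ^ ((I.drop (r + 1)).length * (J.length + 1)) •
        (a * MvPolynomial.pderiv (I[r]'r.2) b) • delList k (I.take r ++ J ++ I.drop (r + 1)) := by
  have contract (i : Fin n) :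
      CliffordAlgebra.contractRight (a • delList k I) (LinearMap.proj i) =
        a • CliffordAlgebra.contractRight (delList k I) (LinearMap.proj i) := by
    rw [map_smul, LinearMap.smul_apply]
  simp only [circPoly_apply, contract, contractRight_delList, coeffDeriv_smul_delList,
    smul_mul_smul_comm, Finset.sum_mul, Finset.smul_sum, ite_mul, zero_mul, smul_ite, smul_zero]
  rw [Finset.sum_comm]
  refine Finset.sum_congr rfl fun r _ => ?_
  rw [Fintype.sum_ite_eq, smul_mul_assoc, delList_append, mul_assoc, ← delList_append k (I.drop _),
    delList_append_comm, mul_smul_comm, ← delList_append, ← List.append_assoc, smul_smul, ← pow_add,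
    smul_comm, mul_add_one, add_comm]

theorem coe_negOnePow_eq_neg_one_pow {z : ℤ} {m : ℕ} (h : Even (z - m)) :
    (z.negOnePow : ℤ) = (-1) ^ m := by
  rw [(Int.negOnePow_eq_iff _ _).2 h, Int.coe_negOnePow_natCast]

theorem circPoly_smul_delList_eq_sum (a b : A k n) (I J : List (Fin n)) :
    circPoly k n (a • delList k I) (b • delList k J) = ∑ r : Fin I.length,
      (Int.negOnePow (((I.length : ℤ) - (r + 1)) * ((J.length : ℤ) - 1)) : ℤ) •
        (a * MvPolynomial.pderiv (I[r]'r.2) b) • delList k (I.take r ++ J ++ I.drop (r + 1)) := by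
  rw [circPoly_smul_delList]
  refine Finset.sum_congr rfl fun r _ => ?_
  rw [coe_negOnePow_eq_neg_one_pow]
  refine ⟨-(I.length - (r + 1)), ?_⟩
  rw [List.length_drop, Nat.cast_mul, Nat.cast_sub r.2]
  push_cast
  ring

theorem negOnePow_smul_circPoly_eq_sum (a b : A k n) (I J : List (Fin n)) :
    (Int.negOnePow (((I.length : ℤ) - 1) * ((J.length : ℤ) - 1)) : ℤ) •
        circPoly k n (b • delList k J) (a • delList k I) = ∑ l : Fin J.length,
      (Int.negOnePow ((((l : ℤ) + 1) - 1) * ((I.length : ℤ) - 1)) : ℤ) •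
        (b * MvPolynomial.pderiv (J[l]'l.2) a) • delList k (J.take l ++ I ++ J.drop (l + 1)) := by
  rw [circPoly_smul_delList_eq_sum, Finset.smul_sum]
  refine Finset.sum_congr rfl fun l _ => ?_
  rw [smul_smul, ← Units.val_mul, ← Int.negOnePow_add]
  congr 2
  rw [Int.negOnePow_eq_iff]
  exact ⟨(I.length - 1) * (J.length - 1 - l), by ring⟩

end

section

variable (k : Type*) [Field k] {n : ℕ}

theorem schouten_eq {p q : ℕ} {x y : Polyvector k n}
    (hx : x ∈ ⋀[A k n]^p (Fin n → A k n)) (hy : y ∈ ⋀[A k n]^q (Fin n → A k n)) :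
    schouten k n x y = circPoly k n x y -
        (Int.negOnePow (((p : ℤ) - 1) * ((q : ℤ) - 1)) : ℤ) • circPoly k n y x := by
  have swap (i : Fin n) :
      coeffDeriv k i x * CliffordAlgebra.contractLeft (LinearMap.proj i) y =
        (-1 : ℤ) ^ ((p + 1) * (q + 1)) •
          (CliffordAlgebra.contractRight y (LinearMap.proj i) * coeffDeriv k i x) := by
    rw [contractRight_eq_of_mem_exteriorPower _ hy, smul_mul_assoc,
      contractLeft_mul_comm_of_mem_exteriorPower _ hy (coeffDeriv_mem k i hx), smul_smul,
      smul_smul, ← pow_add, ← pow_add, Even.neg_one_pow, one_smul]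
    exact ⟨(p + 1) * (q + 1), by ring⟩
  rw [coe_negOnePow_eq_neg_one_pow (m := (p + 1) * (q + 1)), schouten_apply, circPoly_apply,
    circPoly_apply, Finset.smul_sum, ← Finset.sum_sub_distrib]
  · exact Finset.sum_congr rfl fun i _ => by rw [swap]
  · exact ⟨-(p + q), by push_cast; ring⟩

theorem schouten_smul_delList (a b : A k n) (I J : List (Fin n)) :
    schouten k n (a • delList k I) (b • delList k J) =
      ∑ r : Fin I.length,
        (Int.negOnePow (((I.length : ℤ) - (r + 1)) * ((J.length : ℤ) - 1)) : ℤ) •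
          (a * MvPolynomial.pderiv (I[r]'r.2) b) • delList k (I.take r ++ J ++ I.drop (r + 1)) -
      ∑ l : Fin J.length,
        (Int.negOnePow ((((l : ℤ) + 1) - 1) * ((I.length : ℤ) - 1)) : ℤ) •
          (b * MvPolynomial.pderiv (J[l]'l.2) a) • delList k (J.take l ++ I ++ J.drop (l + 1)) := by
  rw [schouten_eq k (smul_delList_mem k a I) (smul_delList_mem k b J),
    circPoly_smul_delList_eq_sum, negOnePow_smul_circPoly_eq_sum]

theorem schouten_mul {p q : ℕ} {x y : Polyvector k n} (hx : x ∈ ⋀[A k n]^p (Fin n → A k n))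
    (hy : y ∈ ⋀[A k n]^q (Fin n → A k n)) (z : Polyvector k n) :
    schouten k n x (y * z) =
      schouten k n x y * z + (-1 : ℤ) ^ ((p + 1) * q) • (y * schouten k n x z) := by
  simp only [schouten_apply, Finset.sum_mul, Finset.mul_sum, Finset.smul_sum]
  rw [← Finset.sum_add_distrib]
  refine Finset.sum_congr rfl fun i _ => ?_
  have contract_y : CliffordAlgebra.contractRight x (LinearMap.proj i) * y =
      (-1 : ℤ) ^ ((p + 1) * q) • (y * CliffordAlgebra.contractRight x (LinearMap.proj i)) :=
    contractRight_mul_comm_of_mem_exteriorPower _ hx hy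
  have deriv_y : coeffDeriv k i x * CliffordAlgebra.involute y =
      (-1 : ℤ) ^ ((p + 1) * q) • (y * coeffDeriv k i x) := by
    rw [involute_of_mem_exteriorPower hy, mul_smul_comm,
      mul_comm_of_mem_exteriorPower (coeffDeriv_mem k i hx) hy, smul_smul, ← pow_add, add_comm,
      add_one_mul]
  rw [coeffDeriv_mul, contractLeft_mul, mul_add, mul_add, ← mul_assoc, ← mul_assoc _ y,
    contract_y, ← mul_assoc, ← mul_assoc _ (CliffordAlgebra.involute y), deriv_y]
  simp only [sub_mul, mul_sub, smul_sub, smul_mul_assoc, mul_assoc]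
  abel

theorem algebraMap_eq_smul_delList (a : A k n) :
    algebraMap (A k n) (Polyvector k n) a = a • delList k [] :=
  Algebra.algebraMap_eq_smul_one a

theorem smul_del_eq_smul_delList (a : A k n) (i : Fin n) : a • del k i = a • delList k [i] := by
  rw [delList_singleton]

theorem isSchoutenNijenhuis_schouten : IsSchoutenNijenhuis (schouten k n) where
  fun_fun a b := by
    rw [algebraMap_eq_smul_delList, algebraMap_eq_smul_delList, schouten_smul_delList]
    exact sub_self 0
  vector_fun a b i := by
    simp only [algebraMap_eq_smul_delList, smul_del_eq_smul_delList, schouten_smul_delList]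
    simp
  vector_vector a b i j := by
    simp only [smul_del_eq_smul_delList, schouten_smul_delList]
    simp
  antisymm p q x y hx hy := by
    rw [schouten_eq k hx hy, schouten_eq k hy hx, smul_sub, smul_smul,
      mul_comm ((q : ℤ) - 1) ((p : ℤ) - 1), neg_sub, ← Units.val_mul, Int.units_mul_self,
      Units.val_one, one_smul]
  leibniz p q x y z hx hy := by
    rw [schouten_mul k hx hy, coe_negOnePow_eq_neg_one_pow]
    exact ⟨-q, by push_cast; ring⟩

variable {k}

theorem IsSchoutenNijenhuis.ext_right
    {β β' : Polyvector k n →ₗ[k] Polyvector k n →ₗ[k] Polyvector k n}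
    (h : IsSchoutenNijenhuis β) (h' : IsSchoutenNijenhuis β') {p : ℕ} {x : Polyvector k n}
    (hx : x ∈ ⋀[A k n]^p (Fin n → A k n))
    (hfun : ∀ b : A k n, β x (b • delList k []) = β' x (b • delList k []))
    (hvec : ∀ (b : A k n) j, β x (b • delList k [j]) = β' x (b • delList k [j])) : β x = β' x := by
  have agree (b : A k n) (l : List (Fin n)) :
      β x (b • delList k l) = β' x (b • delList k l) := by
    induction l generalizing b with
    | nil => exact hfun b
    | cons j l ih =>
      have factor : b • delList k (j :: l) = (b • delList k [j]) * ((1 : A k n) • delList k l) := by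
        rw [one_smul, smul_mul_assoc, ← delList_append, List.singleton_append]
      rw [factor, h.leibniz p 1 _ _ _ hx (smul_delList_mem k b [j]),
        h'.leibniz p 1 _ _ _ hx (smul_delList_mem k b [j]), hvec, ih]
  refine LinearMap.ext fun y => ?_
  induction y using polyvector_induction with
  | add y y' hy hy' => rw [map_add, map_add, hy, hy']
  | smul_delList b l => exact agree b l.reverse

theorem IsSchoutenNijenhuis.ext_swap
    {β β' : Polyvector k n →ₗ[k] Polyvector k n →ₗ[k] Polyvector k n}
    (h : IsSchoutenNijenhuis β) (h' : IsSchoutenNijenhuis β') {p q : ℕ} {x y : Polyvector k n}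
    (hx : x ∈ ⋀[A k n]^p (Fin n → A k n)) (hy : y ∈ ⋀[A k n]^q (Fin n → A k n))
    (hyx : β y x = β' y x) : β x y = β' x y := by
  rw [h.antisymm p q x y hx hy, h'.antisymm p q x y hx hy, hyx]

theorem IsSchoutenNijenhuis.unique
    {β β' : Polyvector k n →ₗ[k] Polyvector k n →ₗ[k] Polyvector k n}
    (h : IsSchoutenNijenhuis β) (h' : IsSchoutenNijenhuis β') : β = β' := by
  have vector_fun (a b : A k n) (i : Fin n) : β (a • delList k [i]) (b • delList k []) =
      β' (a • delList k [i]) (b • delList k []) := by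
    rw [← algebraMap_eq_smul_delList, ← smul_del_eq_smul_delList, h.vector_fun, h'.vector_fun]
  have fun_left (a : A k n) : β (a • delList k []) = β' (a • delList k []) := by
    have ha := smul_delList_mem k a []
    refine h.ext_right h' ha (fun b => ?_) fun b j =>
      h.ext_swap h' ha (smul_delList_mem k b [j]) (vector_fun b a j)
    rw [← algebraMap_eq_smul_delList, ← algebraMap_eq_smul_delList, h.fun_fun, h'.fun_fun]
  have vector_left (a : A k n) (i : Fin n) : β (a • delList k [i]) = β' (a • delList k [i]) := by
    refine h.ext_right h' (smul_delList_mem k a [i]) (fun b => vector_fun a b i) fun b j => ?_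
    rw [← smul_del_eq_smul_delList, ← smul_del_eq_smul_delList, h.vector_vector, h'.vector_vector]
  refine LinearMap.ext fun x => ?_
  induction x using polyvector_induction with
  | add x x' hx hx' => rw [map_add, map_add, hx, hx']
  | smul_delList a l =>
    have hl := smul_delList_mem k a l.reverse
    exact h.ext_right h' hl
      (fun b => h.ext_swap h' hl (smul_delList_mem k b []) (by rw [fun_left]))
      fun b j => h.ext_swap h' hl (smul_delList_mem k b [j]) (by rw [vector_left])

end

/-! ### The bracket of cochains -/

theorem sum_reverse_take_getElem_drop {α M : Type*} [AddCommMonoid M] (l : List α)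
    (F : List α → α → List α → M) :
    ∑ r : Fin l.reverse.length, F (l.reverse.take r) l.reverse[r] (l.reverse.drop (r + 1)) =
      ∑ r : Fin l.length, F (l.drop (r + 1)).reverse l[r] (l.take r).reverse := by
  refine Fintype.sum_equiv ((finCongr l.length_reverse).trans Fin.revPerm) _ _ fun r => ?_
  have hr : r < l.length := l.length_reverse ▸ r.2
  have hrev : l.length - (r + 1) + 1 = l.length - r := by omega
  simp only [Equiv.trans_apply, Fin.revPerm_apply, Fin.getElem_fin, Fin.val_rev, finCongr_apply,
    Fin.val_cast, List.take_reverse, List.drop_reverse, List.getElem_reverse, hrev, Nat.sub_sub,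
    Nat.add_comm 1]

section

variable (k : Type*) [Field k] {n : ℕ}

theorem delList_append_append_swap (l₁ l₂ l₃ : List (Fin n)) : delList k (l₁ ++ l₂ ++ l₃) =
    (-1 : ℤ) ^ (l₃.length * (l₁.length + l₂.length) + l₁.length * l₂.length) •
      delList k (l₃ ++ l₂ ++ l₁) := by
  rw [delList_append_comm, delList_append, delList_append_comm k l₁, mul_smul_comm,
    ← delList_append, List.append_assoc, smul_smul, ← pow_add, List.length_append, mul_comm]

variable {k}

theorem circ_add_left (q : ℕ) (f f' g : K k n →ₗ[k] A k n) :
    circ q (f + f') g = circ q f g + circ q f' g :=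
  LinearMap.add_comp _ _ _

theorem circ_add_right (q : ℕ) (f g g' : K k n →ₗ[k] A k n) :
    circ q f (g + g') = circ q f g + circ q f g' := by
  simp only [circ, idTensorId, tensorId, LinearMap.add_comp, LinearMap.comp_add,
    LinearMap.rTensor_add, LinearMap.lTensor_add, TensorProduct.map_add_right]

theorem circ_zero_right (q : ℕ) (f : K k n →ₗ[k] A k n) : circ q f 0 = 0 :=
  left_eq_add.1 (add_zero (0 : K k n →ₗ[k] A k n) ▸ circ_add_right q f 0 0)

variable (k)

theorem circ_toCochain_of_sortedLT {I : List (Fin n)} (hI : I.SortedLT) (a b : A k n)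
    (J : List (Fin n)) :
    circ J.length (toCochain k n (a • delList k I.reverse)) (toCochain k n (b • delList k J)) =
      toCochain k n (circPoly k n (a • delList k I.reverse) (b • delList k J)) := by
  obtain ⟨J, rfl⟩ := List.reverse_surjective J
  rw [circPoly_smul_delList, sum_reverse_take_getElem_drop I fun s i t =>
    (-1 : ℤ) ^ (t.length * (J.reverse.length + 1)) •
      (a * MvPolynomial.pderiv i b) • delList k (s ++ J.reverse ++ t),
    toCochain_smul_delList_reverse, toCochain_smul_delList_reverse, List.length_reverse,
    circ_dualCochain hI, map_sum]
  refine Finset.sum_congr rfl fun r _ => ?_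
  have hr : (I.take r).length = r := List.length_take_of_le r.2.le
  rw [delList_append_append_swap, ← List.reverse_append, ← List.reverse_append, ← List.append_assoc,
    smul_comm (a * _), smul_smul, ← pow_add, map_zsmul, toCochain_smul_delList_reverse]
  simp only [List.length_reverse, hr]
  have parity (d j t : ℕ) :
      t * (j + 1) + (t * (d + j) + d * j) = d * (j + t) + t + 2 * (t * j) := by
    ring
  rw [parity, pow_add _ _ (2 * _), (even_two.mul_right _).neg_one_pow, mul_one]

theorem circ_toCochain {q : ℕ} (x : Polyvector k n) {y : Polyvector k n}
    (hy : y ∈ ⋀[A k n]^q (Fin n → A k n)) :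
    circ q (toCochain k n x) (toCochain k n y) = toCochain k n (circPoly k n x y) := by
  induction x using polyvector_induction with
  | add x x' hx hx' =>
    rw [map_add, circ_add_left, hx, hx', map_add, LinearMap.add_apply, map_add]
  | smul_delList a I hI =>
    induction hy using exteriorPower_induction with
    | zero => rw [map_zero, map_zero, map_zero, circ_zero_right]
    | add y y' _ _ hy hy' => rw [map_add, circ_add_right, hy, hy', map_add, map_add]
    | smul_delList b J hJ => exact hJ ▸ circ_toCochain_of_sortedLT k hI a b J

theorem bracket_toCochain {p q : ℕ} {x y : Polyvector k n}
    (hx : x ∈ ⋀[A k n]^p (Fin n → A k n)) (hy : y ∈ ⋀[A k n]^q (Fin n → A k n)) :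
    bracket p q (toCochain k n x) (toCochain k n y) = toCochain k n (schouten k n x y) := by
  rw [bracket, circ_toCochain k x hy, circ_toCochain k y hx, schouten_eq k hx hy, map_sub,
    map_zsmul]

end

end KoszulPoly

theorem proposition4p7 (k : Type*) [Field k] (n : ℕ) :
    -- `A[∂_1, …, ∂_n] = Hom_{A^e}(K, A)`, a complex with zero differential
    (Function.Injective (KoszulPoly.toCochain k n) ∧
      Set.range (KoszulPoly.toCochain k n) = KoszulPoly.cochains k n ∧
      ∀ f ∈ KoszulPoly.cochains k n, f ∘ₗ KoszulPoly.koszulD k n = 0) ∧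
    -- the `φ`-circle product
    (∀ (a b : KoszulPoly.A k n) (I J : List (Fin n)),
      KoszulPoly.circ J.length
          (KoszulPoly.toCochain k n (a • KoszulPoly.delList k I))
          (KoszulPoly.toCochain k n (b • KoszulPoly.delList k J)) =
        KoszulPoly.toCochain k n (∑ r : Fin I.length,
          (Int.negOnePow (((I.length : ℤ) - (r + 1)) * ((J.length : ℤ) - 1)) : ℤ) •
            (a * MvPolynomial.pderiv I[r] b) •
              KoszulPoly.delList k (I.take r ++ J ++ I.drop (r + 1)))) ∧
    -- the `φ`-bracket
    (∀ (a b : KoszulPoly.A k n) (I J : List (Fin n)),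
      KoszulPoly.bracket I.length J.length
          (KoszulPoly.toCochain k n (a • KoszulPoly.delList k I))
          (KoszulPoly.toCochain k n (b • KoszulPoly.delList k J)) =
        KoszulPoly.toCochain k n
          (∑ r : Fin I.length,
              (Int.negOnePow (((I.length : ℤ) - (r + 1)) * ((J.length : ℤ) - 1)) : ℤ) •
                (a * MvPolynomial.pderiv I[r] b) •
                  KoszulPoly.delList k (I.take r ++ J ++ I.drop (r + 1)) -
            ∑ l : Fin J.length,
              (Int.negOnePow ((((l : ℤ) + 1) - 1) * ((I.length : ℤ) - 1)) : ℤ) •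
                (b * MvPolynomial.pderiv J[l] a) •
                  KoszulPoly.delList k (J.take l ++ I ++ J.drop (l + 1)))) ∧
    -- the `φ`-bracket is the Schouten–Nijenhuis bracket
    ∃ β : KoszulPoly.Polyvector k n →ₗ[k] KoszulPoly.Polyvector k n →ₗ[k]
        KoszulPoly.Polyvector k n,
      KoszulPoly.IsSchoutenNijenhuis β ∧
      (∀ β', KoszulPoly.IsSchoutenNijenhuis β' → β' = β) ∧
      ∀ (p q : ℕ) (ω η : KoszulPoly.Polyvector k n),
        ω ∈ ⋀[KoszulPoly.A k n]^p (Fin n → KoszulPoly.A k n) →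
        η ∈ ⋀[KoszulPoly.A k n]^q (Fin n → KoszulPoly.A k n) →
        KoszulPoly.bracket p q (KoszulPoly.toCochain k n ω) (KoszulPoly.toCochain k n η) =
          KoszulPoly.toCochain k n (β ω η) := by
  refine ⟨⟨KoszulPoly.toCochain_injective k, KoszulPoly.range_toCochain k,
    fun f hf => KoszulPoly.cochains_comp_koszulD hf⟩, fun a b I J => ?_, fun a b I J => ?_,
    KoszulPoly.schouten k n, KoszulPoly.isSchoutenNijenhuis_schouten k,
    fun β' h => h.unique (KoszulPoly.isSchoutenNijenhuis_schouten k), fun p q ω η hω hη =>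
      KoszulPoly.bracket_toCochain k hω hη⟩
  · rw [KoszulPoly.circ_toCochain k _ (KoszulPoly.smul_delList_mem k b J),
      KoszulPoly.circPoly_smul_delList_eq_sum]
  · rw [KoszulPoly.bracket_toCochain k (KoszulPoly.smul_delList_mem k a I)
      (KoszulPoly.smul_delList_mem k b J), KoszulPoly.schouten_smul_delList]
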